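/- Let $n\ge 1$, let $G=SL_{n+1}(\mathbb{C})$ with centre $Z$, let $T\subset G$ be the torus of diagonal matrices, $T_{ad}=T/Z$, and let $\mathfrak{u}$ be the Lie algebra of strictly upper triangular $(n+1)\times(n+1)$ complex matrices. For $1\le i\le n$ let $\alpha_i(t)=t_it_{i+1}^{-1}$ be the simple roots and $X_{\alpha_i}=E_{i,i+1}$ the simple root vectors. Let $W_{ad}=\mathfrak{u}/[\mathfrak{u},\mathfrak{u}]$, identified with the span of the $X_{\alpha_i}$. For a lattice $L$ of characters of $T$ let $S_L$ be the semigroup of all $\chi\in L$ some positive multiple of which is a sum of simple roots. Let $W$ be the affine toric variety $\operatorname{Spec}\mathbb{C}[S_{X(T)}]$, where $X(T)$ is the character group of $T$; the analogous variety for the character group of $T_{ad}$ (the root lattice) is identified with $W_{ad}$, the function $\chi^{\alpha_i}$ being the coordinate along $X_{\alpha_i}$. Let $\rho:W\to W/Z=W_{ad}$ be the quotient map, dual to the inclusion of semigroups. For $J\subseteq\{1,\dots,n\}$ let $\tau_J\subset W_{ad}$ be the $T_{ad}$-orbit of $X_J=\sum_{i\notin J}X_{\alpha_i}$, and let $Z(J)=Z/Z^J$,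 where $Z^J$ is the subgroup of elements of $Z$ acting trivially on $\rho^{-1}(\tau_J)$. Write $J=\{d_1<\dots<d_r\}$, let $P(J)$ be the partition of $n+1$ with parts $n+1-d_r,\ d_r-d_{r-1},\ \dots,\ d_2-d_1,\ d_1$ (the single part $n+1$ if $J=\emptyset$), and let $c=\gcd(J\cup\{n+1\})$. Let $x\in\tau_J$, regarded as a nilpotent matrix in the span of the $X_{\alpha_i}$, let $\mathscr{O}_x=\{gxg^{-1}: g\in G\}$ with its Euclidean topology, and let $\pi_1(\mathscr{O}_x)$ be its fundamental group with base point $x$. Then: 1. the fiber $\rho^{-1}(x)$ is non-empty and is a torsor under $Z(J)$: it is a single $Z$-orbit, and the stabilizer in $Z$ of each of its points is $Z^J$ (so that a choice of base point identifies the fiber with the group $Z(J)$); 2. $Z(J)\cong\pi_1(\mathscr{O}_x)$, and both groups are isomorphic to $\mathbb{Z}/c\mathbb{Z}$; 3. $c$ is the greatest common divisor of the parts of $P(J)$. -/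

import Mathlib

namespace Graham

noncomputable section

attribute [local instance 100] LieRing.ofAssociativeRing

/-- The simply connected group `G = SL_{n+1}(ℂ)` of type `A_n`. -/
abbrev G (n : ℕ) : Type := Matrix.SpecialLinearGroup (Fin (n + 1)) ℂ

/-- The maximal torus `T` of `G`: tuples `(t_0, …, t_n)` of nonzero complex numbers with product
one, that is, the diagonal matrices in `SL_{n+1}(ℂ)` (see `torusToSL`). -/
def torus (n : ℕ) : Subgroup (Fin (n + 1) → ℂˣ) where
  carrier := {t | ∏ i, t i = 1}
  one_mem' := by
    change ∏ i : Fin (n + 1), (1 : Fin (n + 1) → ℂˣ) i = 1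
    simp
  mul_mem' := by
    intro a b ha hb
    change ∏ i, a i = 1 at ha
    change ∏ i, b i = 1 at hb
    change ∏ i, (a * b) i = 1
    simp [Finset.prod_mul_distrib, ha, hb]
  inv_mem' := by
    intro a ha
    change ∏ i, a i = 1 at ha
    change ∏ i, (a⁻¹) i = 1
    simp [Finset.prod_inv_distrib, ha]

theorem torus_det (n : ℕ) (t : torus n) :
    (Matrix.diagonal fun i => (t.1 i : ℂ)).det = 1 := by
  have h : ∏ i, t.1 i = 1 := t.2
  rw [Matrix.det_diagonal, ← Units.coe_prod, h, Units.val_one]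

/-- The inclusion `T → G` of the diagonal matrices. -/
def torusToSL (n : ℕ) : torus n →* G n where
  toFun t := ⟨Matrix.diagonal fun i => (t.1 i : ℂ), torus_det n t⟩
  map_one' := Subtype.ext <| by
    change Matrix.diagonal (fun i => (((1 : torus n).1 i : ℂˣ) : ℂ)) = 1
    simp
  map_mul' s t := Subtype.ext <| by
    change Matrix.diagonal (fun i => (((s * t).1 i : ℂˣ) : ℂ)) =
      Matrix.diagonal (fun i => (s.1 i : ℂ)) * Matrix.diagonal (fun i => (t.1 i : ℂ))
    rw [Matrix.diagonal_mul_diagonal]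
    simp

/-- The centre `Z` of `G`, regarded as a subgroup of `T`. -/
def centre (n : ℕ) : Subgroup (torus n) :=
  (Subgroup.center (G n)).comap (torusToSL n)

/-- The coordinate character `t ↦ t_i` of `T`. -/
def coordChar (n : ℕ) (i : Fin (n + 1)) : torus n →* ℂˣ :=
  (Pi.evalMonoidHom (fun _ : Fin (n + 1) => ℂˣ) i).comp (torus n).subtype

/-- The simple root `α_{i+1} : t ↦ t_i t_{i+1}⁻¹` (the index `i` runs through `0, …, n - 1`). -/
def simpleRoot (n : ℕ) (i : Fin n) : torus n →* ℂˣ :=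
  coordChar n i.castSucc / coordChar n i.succ

/-- The character group of `T` (the weight lattice), written multiplicatively. -/
def weightLattice (n : ℕ) : Subgroup (torus n →* ℂˣ) :=
  Subgroup.closure (Set.range (coordChar n))

/-- The character group of `T_ad = T / Z` (the root lattice), written multiplicatively. -/
def rootLattice (n : ℕ) : Subgroup (torus n →* ℂˣ) :=
  Subgroup.closure (Set.range (simpleRoot n))

/-- The simple roots are characters of `T`. -/
theorem rootLattice_le (n : ℕ) : rootLattice n ≤ weightLattice n := by
  rw [rootLattice, Subgroup.closure_le]
  rintro _ ⟨i, rfl⟩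
  exact div_mem (Subgroup.subset_closure (Set.mem_range_self i.castSucc))
    (Subgroup.subset_closure (Set.mem_range_self i.succ))

/-- The semigroup `σ^∨ ∩ L` of a lattice `L` of characters of `T`, where `σ` is the cone generated
by the fundamental (co)weights. The dual cone `σ^∨` is the rational cone generated by the simple
roots, so a character lies in it when some positive multiple of it is a sum of simple roots. -/
def coneMonoid (n : ℕ) (L : Subgroup (torus n →* ℂˣ)) : Submonoid (torus n →* ℂˣ) where
  carrier := {χ | χ ∈ L ∧ ∃ k : ℕ, 0 < k ∧
    χ ^ k ∈ Submonoid.closure (Set.range (simpleRoot n))}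
  one_mem' := ⟨one_mem L, 1, one_pos, by rw [one_pow]; exact one_mem _⟩
  mul_mem' := by
    rintro a b ⟨ha, k, hk, hak⟩ ⟨hb, l, hl, hbl⟩
    refine ⟨mul_mem ha hb, k * l, Nat.mul_pos hk hl, ?_⟩
    rw [mul_pow, pow_mul a k l, mul_comm k l, pow_mul b l k]
    exact mul_mem (pow_mem hak l) (pow_mem hbl k)

theorem coneMonoid_mono (n : ℕ) {L L' : Subgroup (torus n →* ℂˣ)} (h : L ≤ L') :
    coneMonoid n L ≤ coneMonoid n L' := fun _ hχ => ⟨h hχ.1, hχ.2⟩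

theorem simpleRoot_mem_coneMonoid (n : ℕ) (i : Fin n) :
    simpleRoot n i ∈ coneMonoid n (rootLattice n) :=
  ⟨Subgroup.subset_closure (Set.mem_range_self i), 1, one_pos, (pow_one (simpleRoot n i)).symm ▸
    Submonoid.subset_closure (Set.mem_range_self i)⟩

/-- The (closed points of the) affine toric variety `Spec ℂ[σ^∨ ∩ L]`: the semigroup
homomorphisms from `σ^∨ ∩ L` to `(ℂ, ·)`. -/
@[ext]
structure ToricVariety (n : ℕ) (L : Subgroup (torus n →* ℂˣ)) where
  /-- The value of the function `χ` at the point. -/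
  eval : coneMonoid n L →* ℂ

/-- The action of `T` on the toric variety, `(t • y)(χ) = χ(t) y(χ)`. -/
instance (n : ℕ) (L : Subgroup (torus n →* ℂˣ)) : MulAction (torus n) (ToricVariety n L) where
  smul t y := {
    eval := {
      toFun := fun χ => ((χ : torus n →* ℂˣ) t : ℂ) * y.eval χ
      map_one' := by simp
      map_mul' := by
        intro a b
        simp only [Submonoid.coe_mul, MonoidHom.mul_apply, Units.val_mul, map_mul]
        ring } }
  one_smul y := ToricVariety.ext <| MonoidHom.ext fun χ => by
    change ((χ : torus n →* ℂˣ) 1 : ℂ) * _ = _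
    rw [map_one, Units.val_one, one_mul]
  mul_smul s t y := ToricVariety.ext <| MonoidHom.ext fun χ => by
    change ((χ : torus n →* ℂˣ) (s * t) : ℂ) * _ =
      ((χ : torus n →* ℂˣ) s : ℂ) * (((χ : torus n →* ℂˣ) t : ℂ) * _)
    rw [map_mul, Units.val_mul, mul_assoc]

/-- The toric variety `W` for `T`. -/
abbrev W (n : ℕ) : Type := ToricVariety n (weightLattice n)

/-- The toric variety for `T_ad`, with the same cone as `W`. -/
abbrev WadToric (n : ℕ) : Type := ToricVariety n (rootLattice n)

/-- The map from `W` to the toric variety of `T_ad` dual to the inclusion of semigroups. -/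
def restrict (n : ℕ) (y : W n) : WadToric n :=
  ⟨y.eval.comp (Submonoid.inclusion (coneMonoid_mono n (rootLattice_le n)))⟩

/-- The nilradical `𝔲` of the Lie algebra of the Borel subgroup `B` of upper triangular
matrices: the strictly upper triangular matrices. -/
def nilradical (n : ℕ) : LieSubalgebra ℂ (Matrix (Fin (n + 1)) (Fin (n + 1)) ℂ) where
  carrier := {x | ∀ i j, j ≤ i → x i j = 0}
  zero_mem' := by intro i j _; rfl
  add_mem' := by
    intro x y hx hy i j hij
    rw [Matrix.add_apply, hx i j hij, hy i j hij, add_zero]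
  smul_mem' := by
    intro c x hx i j hij
    rw [Matrix.smul_apply, hx i j hij, smul_zero]
  lie_mem' := by
    have key : ∀ x y : Matrix (Fin (n + 1)) (Fin (n + 1)) ℂ,
        (∀ i j, j ≤ i → x i j = 0) → (∀ i j, j ≤ i → y i j = 0) →
        ∀ i j, j ≤ i → (x * y) i j = 0 := by
      intro x y hx hy i j hij
      rw [Matrix.mul_apply]
      refine Finset.sum_eq_zero fun k _ => ?_
      rcases le_total k i with hk | hk
      · rw [hx i k hk, zero_mul]
      · rw [hy k j (hij.trans hk), mul_zero]
    intro x y hx hy i j hij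
    rw [Ring.lie_def, Matrix.sub_apply, key x y hx hy i j hij, key y x hy hx i j hij, sub_zero]

/-- `W_ad = 𝔲 / [𝔲, 𝔲]`. -/
abbrev Wad (n : ℕ) : Type :=
  nilradical n ⧸ ⁅(⊤ : LieIdeal ℂ (nilradical n)), (⊤ : LieIdeal ℂ (nilradical n))⁆

/-- The projection `𝔲 → W_ad`. -/
def toWad (n : ℕ) (x : nilradical n) : Wad n := LieSubmodule.Quotient.mk x

/-- The simple root vector `X_{α_{i+1}}`, the matrix unit directly above the diagonal in row `i`
(the index `i` runs through `0, …, n - 1`). -/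
def simpleRootVector (n : ℕ) (i : Fin n) : nilradical n :=
  ⟨Matrix.single i.castSucc i.succ 1, by
    intro a b hab
    apply Matrix.single_apply_of_ne
    rintro ⟨rfl, rfl⟩
    exact absurd hab (not_le.mpr i.castSucc_lt_succ)⟩

/-- The span of the simple root vectors. It maps isomorphically and `T`-equivariantly onto
`W_ad`, and through it the elements of `W_ad` are regarded as nilpotent matrices. -/
def simpleRootSpan (n : ℕ) : Submodule ℂ (nilradical n) :=
  Submodule.span ℂ (Set.range (simpleRootVector n))

/-- The identification of the toric variety of `T_ad` with `𝔲 / [𝔲, 𝔲]`: the function `χ^{α_i}`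
is the coordinate along the simple root vector `X_{α_i}`. -/
def wadChart (n : ℕ) (w : WadToric n) : Wad n :=
  toWad n (∑ i : Fin n,
    w.eval ⟨simpleRoot n i, simpleRoot_mem_coneMonoid n i⟩ • simpleRootVector n i)

/-- The quotient map `ρ : W → W / Z = W_ad`. -/
def rho (n : ℕ) (y : W n) : Wad n := wadChart n (restrict n y)

/-- The adjoint action of `t ∈ T` on `𝔲`, `x ↦ t x t⁻¹`. It depends only on the image of `t` in
`T_ad`. -/
def torusAd (n : ℕ) (t : torus n) (x : nilradical n) : nilradical n :=
  ⟨(torusToSL n t).1 * x.1 * (torusToSL n t⁻¹).1, by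
    intro i j hij
    have h : x.1 i j = 0 := x.2 i j hij
    change (Matrix.diagonal (fun k => (t.1 k : ℂ)) * x.1 *
      Matrix.diagonal (fun k => (t⁻¹.1 k : ℂ))) i j = 0
    rw [Matrix.mul_diagonal, Matrix.diagonal_mul, h, mul_zero, zero_mul]⟩

/-- The representative `X_J`, the sum of the `X_{α_i}` over all `i ∈ {1, …, n}` not in `J`. -/
def repX (n : ℕ) (J : Finset ℕ) : nilradical n :=
  ∑ i : Fin n, if (i : ℕ) + 1 ∈ J then 0 else simpleRootVector n i

/-- The `T_ad`-orbit `τ_J` in `W_ad`: the orbit of the class of `X_J`. -/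
def tau (n : ℕ) (J : Finset ℕ) : Set (Wad n) :=
  Set.range fun t : torus n => toWad n (torusAd n t (repX n J))

/-- The fibre of `ρ` over a point of `W_ad`. -/
def fibre (n : ℕ) (w : Wad n) : Set (W n) := {y | rho n y = w}

/-- The subgroup of `Z` of elements that act trivially on the fibres of `ρ` over `τ_J`. -/
def fixer (n : ℕ) (J : Finset ℕ) : Subgroup (centre n) :=
  fixingSubgroup (centre n) {y : W n | rho n y ∈ tau n J}

/-- The group `Z(J)`: the group through which `Z` acts on the fibres of `ρ` over `τ_J`. Each of
these fibres is a torsor under it (this is asserted, not assumed, in the theorem), and it becomes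
identified with `Z(J)` when a base point is chosen. -/
abbrev Z (n : ℕ) (J : Finset ℕ) : Type := centre n ⧸ fixer n J

/-- The nilpotent orbit `𝒪_x = {g x g⁻¹ | g ∈ G}`, with the Euclidean topology of the space of
complex matrices. -/
def nilpotentOrbit (n : ℕ) (x : nilradical n) :
    Set (Matrix (Fin (n + 1)) (Fin (n + 1)) ℂ) :=
  Set.range fun g : G n => g.1 * x.1 * (g⁻¹).1

theorem mem_nilpotentOrbit (n : ℕ) (x : nilradical n) : x.1 ∈ nilpotentOrbit n x :=
  ⟨1, by simp⟩

/-- The topological fundamental group `π_1(𝒪_x)`, with base point `x`. -/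
abbrev orbitPi1 (n : ℕ) (x : nilradical n) : Type :=
  FundamentalGroup (nilpotentOrbit n x) ⟨x.1, mem_nilpotentOrbit n x⟩

/-- The parts of the partition `P(J)` of `n + 1`: for each `d ∈ J ∪ {n + 1}`, the distance from
`d` to the preceding element of `J ∪ {0}`. -/
def partsP (n : ℕ) (J : Finset ℕ) : Multiset ℕ :=
  (insert (n + 1) J).val.map fun d => d - ((insert 0 J).filter (· < d)).sup id

end

end Graham

/-! Put m = (n+1)/c. Everything rests on the character ζ ↦ ζ^m of the centre, which consists of the
scalars ζ with ζ^(n+1) = 1. This character maps `centre n` onto the c-th roots of unity. Its kernel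
turns out to be both the stabilizer Z^J and the part of Z inside the identity component of the
centralizer of x, so both groups in the theorem are the same quotient of Z.

Fibres. A point of W over τ_J is nonzero exactly on the face of characters orthogonal to the
fundamental coweights indexed by J (`eval_ne_zero_iff`). The weights orthogonal to these coweights
are generated by the simple roots outside J and one further character η, the product of the
coordinates t_p with c ∣ p, counting p from 0 (`mem_closure_faceGens`). Such a point is therefore
determined by its image in W_ad and its value at η. The c-th power of that value is fixed by the
image, since η^c is a product of simple roots (`eta_pow`), and Z multiplies it by ζ^m
(`eta_centre`).

Fundamental group. G is simply connected: nowhere vanishing functions are dense on the circle, so a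
loop in SL can be reduced to the identity by elementary row operations
(`isNullFamily_of_det_eq_one`). Let C be the centralizer of x and C₀ its identity component. Then
G/C₀ is simply connected and covers the orbit with group Z/(Z ∩ C₀), provided C = Z·C₀
(`IsOrbitMap.nonempty_fundamentalGroup_mulEquiv`). The equality C = Z·C₀ comes from joining g to 1
in the complex line through them and normalizing the determinant
(`exists_centre_mul_mem_component`). A diagonal path built from Bézout coefficients puts every ζ
with ζ^m = 1 into C₀ (`centre_mem_component`). Conversely, the minor of a commuting matrix on the
indices divisible by c is a c-th root of its determinant (`residueDet_pow`). On C it is thus locally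
constant, it equals 1 on C₀, and at a scalar ζ it equals ζ^m. -/

namespace Graham

open scoped unitInterval Topology

/-! ### Contracting families of matrices of determinant one by row operations -/

section NullHomotopy

variable {X : Type*} [TopologicalSpace X]

/-- A family of square matrices of determinant one, parametrized by `X`, which is homotopic to the
constant family `1` through such families. -/
def IsNullFamily {ι : Type*} [Fintype ι] [DecidableEq ι] (M : X → Matrix ι ι ℂ) : Prop :=
  ∃ H : I × X → Matrix ι ι ℂ, Continuous H ∧ (∀ p, (H p).det = 1) ∧
    (∀ x, H (0, x) = 1) ∧ ∀ x, H (1, x) = M x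

variable (X) in
/-- Nowhere vanishing functions are dense among the continuous complex functions on `X`. -/
def NowhereZeroDense : Prop :=
  ∀ f : X → ℂ, Continuous f → ∀ ε > 0, ∃ g : X → ℂ,
    Continuous g ∧ (∀ x, g x ≠ 0) ∧ ∀ x, ‖g x - f x‖ < ε

/-- If nowhere vanishing functions are dense, then the ring of continuous functions has stable
rank one. -/
theorem NowhereZeroDense.exists_add_sum_ne_zero [CompactSpace X] (hX : NowhereZeroDense X)
    {ι : Type*} [Fintype ι] {a : X → ℂ} (ha : Continuous a) {c : X → ι → ℂ} (hc : Continuous c)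
    (hac : ∀ x, a x = 0 → c x ≠ 0) :
    ∃ h : X → ι → ℂ, Continuous h ∧ ∀ x, a x + ∑ i, h x i * c x i ≠ 0 := by
  rcases isEmpty_or_nonempty X with hE | hE
  · exact ⟨fun _ _ => 0, continuous_const, fun x => (hE.false x).elim⟩
  have hci : ∀ i, Continuous fun x => c x i := fun i => (continuous_apply i).comp hc
  set F : X → ℝ := fun x => ∑ i, ‖c x i‖ ^ 2 with hF
  have hFc : Continuous F := continuous_finsetSum _ fun i _ => (hci i).norm.pow 2
  have hF0 : ∀ x, 0 ≤ F x := fun x => Finset.sum_nonneg fun i _ => by positivity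
  obtain ⟨x₀, -, hx₀⟩ := isCompact_univ.exists_isMinOn (Set.univ_nonempty)
    (ha.norm.add hFc).continuousOn
  have hpos : 0 < ‖a x₀‖ + F x₀ := by
    rcases eq_or_ne (a x₀) 0 with h | h
    · have h2 := hac x₀ h
      obtain ⟨i, hi⟩ := Function.ne_iff.mp h2
      have : 0 < F x₀ := Finset.sum_pos' (fun i _ => by positivity)
        ⟨i, Finset.mem_univ _, by have := norm_pos_iff.mpr hi; positivity⟩
      have := norm_nonneg (a x₀); linarith
    · have := norm_pos_iff.mpr h; have := hF0 x₀; linarith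
  set δ := (‖a x₀‖ + F x₀) / 2 with hδ
  have hδ0 : 0 < δ := by positivity
  have hmin : ∀ x, 2 * δ ≤ ‖a x‖ + F x := fun x => by
    have : ‖a x₀‖ + F x₀ ≤ ‖a x‖ + F x := hx₀ (Set.mem_univ x)
    linarith
  obtain ⟨g, hg, hg0, hga⟩ := hX a ha δ hδ0
  have hm : ∀ x, 0 < max (F x) δ := fun x => lt_max_of_lt_right hδ0
  -- Where F ≥ δ the correction turns a into g exactly. Where F < δ the choice of δ forces ‖a‖ > δ,
  -- and a correction of norm at most ‖g - a‖ < δ cannot cancel a.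
  refine ⟨fun x i => (starRingEnd ℂ) (c x i) * ((g x - a x) / ((max (F x) δ : ℝ) : ℂ)), ?_, ?_⟩
  · refine continuous_pi fun i => ?_
    refine (Complex.continuous_conj.comp (hci i)).mul ((hg.sub ha).div ?_ ?_)
    · exact Complex.continuous_ofReal.comp (hFc.max continuous_const)
    · intro x; exact_mod_cast (hm x).ne'
  · intro x
    have hs : ∑ i, (starRingEnd ℂ) (c x i) * ((g x - a x) / ((max (F x) δ : ℝ) : ℂ)) * c x i =
        ((F x / max (F x) δ : ℝ) : ℂ) * (g x - a x) := by
      have : ((F x : ℝ) : ℂ) = ∑ i, (starRingEnd ℂ) (c x i) * c x i := by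
        rw [hF]; push_cast
        refine Finset.sum_congr rfl fun i _ => ?_
        rw [mul_comm, Complex.mul_conj, Complex.normSq_eq_norm_sq]; push_cast; rfl
      rw [Complex.ofReal_div, this, Finset.sum_div, Finset.sum_mul]
      refine Finset.sum_congr rfl fun i _ => ?_
      ring
    rw [hs]
    rcases le_or_gt δ (F x) with h | h
    · rw [max_eq_left h, div_self (hδ0.trans_le h).ne']
      simpa using hg0 x
    · rw [max_eq_right h.le]
      intro h0
      have h1 : a x = -(((F x / δ : ℝ) : ℂ) * (g x - a x)) := eq_neg_of_add_eq_zero_left h0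
      have h2 : ‖a x‖ ≤ ‖g x - a x‖ := by
        rw [h1, norm_neg, norm_mul, Complex.norm_real, Real.norm_of_nonneg (by
          have := hF0 x; positivity), ← h1]
        have : F x / δ ≤ 1 := (div_le_one hδ0).mpr h.le
        nlinarith [norm_nonneg (g x - a x)]
      have := hga x
      have := hmin x
      linarith

variable {ι κ : Type*} [Fintype ι] [DecidableEq ι] [Fintype κ] [DecidableEq κ]

theorem IsNullFamily.mul {M N : X → Matrix ι ι ℂ} (hM : IsNullFamily M) (hN : IsNullFamily N) :
    IsNullFamily fun x => M x * N x := by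
  obtain ⟨H, hc, hd, h0, h1⟩ := hM
  obtain ⟨K, kc, kd, k0, k1⟩ := hN
  exact ⟨fun p => H p * K p, hc.matrix_mul kc, fun p => by rw [Matrix.det_mul, hd, kd, one_mul],
    fun x => by simp only [h0, k0, one_mul], fun x => by simp only [h1, k1]⟩

/-- The adjugate is a continuous inverse along the homotopy, since determinants are 1. This is how
an elementary factor is stripped off. -/
theorem IsNullFamily.of_mul_left {L M N : X → Matrix ι ι ℂ} (hL : IsNullFamily L)
    (hLM : ∀ x, L x * M x = N x) (hN : IsNullFamily N) : IsNullFamily M := by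
  obtain ⟨H, hc, hd, h0, h1⟩ := hL
  obtain ⟨K, kc, kd, k0, k1⟩ := hN
  have had : ∀ p, (H p).adjugate * H p = 1 := fun p => by
    rw [Matrix.adjugate_mul, hd, one_smul]
  refine ⟨fun p => (H p).adjugate * K p, hc.matrix_adjugate.matrix_mul kc, fun p => ?_,
    fun x => ?_, fun x => ?_⟩
  · rw [Matrix.det_mul, Matrix.det_adjugate, hd, kd, one_pow, one_mul]
  · simp only [h0, k0, Matrix.adjugate_one, one_mul]
  · have h := had (1, x)
    rw [h1] at h
    simp only [h1, k1, ← hLM]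
    rw [← Matrix.mul_assoc, h, one_mul]

theorem IsNullFamily.reindex (e : ι ≃ κ) {M : X → Matrix ι ι ℂ} (hM : IsNullFamily M) :
    IsNullFamily fun x => Matrix.reindex e e (M x) := by
  obtain ⟨H, hc, hd, h0, h1⟩ := hM
  exact ⟨fun p => Matrix.reindex e e (H p), hc.matrix_reindex e e,
    fun p => by rw [Matrix.det_reindex_self, hd], fun x => by simp [h0], fun x => by simp [h1]⟩

theorem isNullFamily_upper {b : X → Matrix κ ι ℂ} (hb : Continuous b) :
    IsNullFamily fun x => Matrix.fromBlocks 1 (b x) 0 1 :=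
  ⟨fun p => Matrix.fromBlocks 1 (((p.1 : ℝ) : ℂ) • b p.2) 0 1,
    continuous_const.matrix_fromBlocks
      ((by fun_prop : Continuous fun p : I × X => ((p.1 : ℝ) : ℂ)).smul (hb.comp continuous_snd))
      continuous_const continuous_const,
    fun p => by rw [Matrix.det_fromBlocks_zero₂₁, Matrix.det_one, Matrix.det_one, one_mul],
    fun x => by simp, fun x => by simp⟩

theorem isNullFamily_lower {c : X → Matrix ι κ ℂ} (hc : Continuous c) :
    IsNullFamily fun x => Matrix.fromBlocks 1 0 (c x) 1 :=
  ⟨fun p => Matrix.fromBlocks 1 0 (((p.1 : ℝ) : ℂ) • c p.2) 1,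
    continuous_const.matrix_fromBlocks continuous_const
      ((by fun_prop : Continuous fun p : I × X => ((p.1 : ℝ) : ℂ)).smul (hc.comp continuous_snd))
      continuous_const,
    fun p => by rw [Matrix.det_fromBlocks_zero₁₂, Matrix.det_one, Matrix.det_one, one_mul],
    fun x => by simp, fun x => by simp⟩

theorem IsNullFamily.fromBlocks_one {d : X → Matrix ι ι ℂ} (hd : IsNullFamily d) :
    IsNullFamily fun x => Matrix.fromBlocks (1 : Matrix κ κ ℂ) 0 0 (d x) := by
  obtain ⟨H, hc, hd, h0, h1⟩ := hd
  exact ⟨fun p => Matrix.fromBlocks 1 0 0 (H p),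
    continuous_const.matrix_fromBlocks continuous_const continuous_const hc,
    fun p => by rw [Matrix.det_fromBlocks_zero₁₂, Matrix.det_one, hd, one_mul],
    fun x => by simp [h0], fun x => by simp [h1]⟩

/-- The induction step of column reduction over a ring of functions of stable rank one. -/
theorem isNullFamily_sum [CompactSpace X] (hX : NowhereZeroDense X) [Nonempty ι]
    (ih : ∀ d : X → Matrix ι ι ℂ, Continuous d → (∀ x, (d x).det = 1) → IsNullFamily d)
    {M : X → Matrix (Unit ⊕ ι) (Unit ⊕ ι) ℂ} (hM : Continuous M) (hdet : ∀ x, (M x).det = 1) :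
    IsNullFamily M := by
  -- `s1` to `s4` treat the stages of the reduction in reverse order: a cleared first column, a
  -- corner equal to 1, a constant unit vector below the corner, a nonvanishing corner.
  have s1 : ∀ (b : X → Matrix Unit ι ℂ) (d : X → Matrix ι ι ℂ), Continuous b → Continuous d →
      (∀ x, (Matrix.fromBlocks 1 (b x) 0 (d x)).det = 1) →
      IsNullFamily fun x => Matrix.fromBlocks 1 (b x) 0 (d x) := by
    intro b d hb hd h
    have hd1 : ∀ x, (d x).det = 1 := fun x => by
      have := h x; rwa [Matrix.det_fromBlocks_zero₂₁, Matrix.det_one, one_mul] at this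
    have := (ih d hd hd1).fromBlocks_one (κ := Unit) |>.mul (isNullFamily_upper hb)
    simpa [Matrix.fromBlocks_multiply] using this
  have s2 : ∀ (b : X → Matrix Unit ι ℂ) (c : X → Matrix ι Unit ℂ) (d : X → Matrix ι ι ℂ),
      Continuous b → Continuous c → Continuous d →
      (∀ x, (Matrix.fromBlocks 1 (b x) (c x) (d x)).det = 1) →
      IsNullFamily fun x => Matrix.fromBlocks 1 (b x) (c x) (d x) := by
    intro b c d hb hc hd h
    have e : ∀ x, Matrix.fromBlocks 1 0 (-c x) 1 * Matrix.fromBlocks 1 (b x) (c x) (d x) =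
        Matrix.fromBlocks 1 (b x) 0 (-c x * b x + d x) := fun x => by
      simp [Matrix.fromBlocks_multiply]
    refine (isNullFamily_lower hc.neg).of_mul_left e ?_
    refine s1 b _ hb ((hc.neg.matrix_mul hb).add hd) fun x => ?_
    rw [← e, Matrix.det_mul, h, Matrix.det_fromBlocks_zero₁₂]; simp
  let i₀ : ι := Classical.arbitrary ι
  -- With the unit vector `k` below the corner a, adding (1 - a)kᵀ times the lower rows makes the
  -- corner 1, because kᵀk = 1.
  let k : Matrix ι Unit ℂ := Matrix.single i₀ () 1
  have hk : (k.transpose * k) = 1 := by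
    ext i j; simp [k, Matrix.mul_apply, Matrix.single_apply]
  have s3 : ∀ (a : X → Matrix Unit Unit ℂ) (b : X → Matrix Unit ι ℂ) (d : X → Matrix ι ι ℂ),
      Continuous a → Continuous b → Continuous d →
      (∀ x, (Matrix.fromBlocks (a x) (b x) k (d x)).det = 1) →
      IsNullFamily fun x => Matrix.fromBlocks (a x) (b x) k (d x) := by
    intro a b d ha hb hd h
    have hu : Continuous fun x => (1 - a x) * k.transpose :=
      (continuous_const.sub ha).matrix_mul continuous_const
    have e : ∀ x, Matrix.fromBlocks 1 ((1 - a x) * k.transpose) 0 1 *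
        Matrix.fromBlocks (a x) (b x) k (d x) =
        Matrix.fromBlocks 1 (b x + (1 - a x) * k.transpose * d x) k (d x) := fun x => by
      simp [Matrix.fromBlocks_multiply, Matrix.mul_assoc, hk]
    refine (isNullFamily_upper hu).of_mul_left e ?_
    refine s2 _ _ _ (hb.add (hu.matrix_mul hd)) continuous_const hd fun x => ?_
    rw [← e, Matrix.det_mul, h, Matrix.det_fromBlocks_zero₂₁]; simp
  have s4 : ∀ (a : X → Matrix Unit Unit ℂ) (b : X → Matrix Unit ι ℂ) (c : X → Matrix ι Unit ℂ)
      (d : X → Matrix ι ι ℂ), Continuous a → Continuous b → Continuous c → Continuous d →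
      (∀ x, a x () () ≠ 0) → (∀ x, (Matrix.fromBlocks (a x) (b x) (c x) (d x)).det = 1) →
      IsNullFamily fun x => Matrix.fromBlocks (a x) (b x) (c x) (d x) := by
    intro a b c d ha hb hc hd ha0 h
    have ha1 : Continuous fun x => (a x () ())⁻¹ := (ha.matrix_elem () ()).inv₀ ha0
    have hw : Continuous fun x => (a x () ())⁻¹ • (k - c x) := ha1.smul (continuous_const.sub hc)
    have e : ∀ x, Matrix.fromBlocks 1 0 ((a x () ())⁻¹ • (k - c x)) 1 *
        Matrix.fromBlocks (a x) (b x) (c x) (d x) =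
        Matrix.fromBlocks (a x) (b x) k ((a x () ())⁻¹ • (k - c x) * b x + d x) := fun x => by
      have : (a x () ())⁻¹ • (k - c x) * a x + c x = k := by
        ext i j
        have := ha0 x
        simp only [Matrix.add_apply, Matrix.mul_apply, Matrix.smul_apply, Matrix.sub_apply,
          Finset.univ_unique, Finset.sum_singleton, smul_eq_mul, PUnit.default_eq_unit]
        field_simp
        ring
      simp only [Matrix.fromBlocks_multiply, Matrix.one_mul, Matrix.zero_mul, add_zero, this]
    refine (isNullFamily_lower hw).of_mul_left e ?_
    refine s3 _ _ _ ha hb ((hw.matrix_mul hb).add hd) fun x => ?_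
    rw [← e, Matrix.det_mul, h, Matrix.det_fromBlocks_zero₁₂]; simp
  have hM11 : Continuous fun x => (M x).toBlocks₁₁ :=
    continuous_matrix fun i j => hM.matrix_elem _ _
  have hM12 : Continuous fun x => (M x).toBlocks₁₂ :=
    continuous_matrix fun i j => hM.matrix_elem _ _
  have hM21 : Continuous fun x => (M x).toBlocks₂₁ :=
    continuous_matrix fun i j => hM.matrix_elem _ _
  have hM22 : Continuous fun x => (M x).toBlocks₂₂ :=
    continuous_matrix fun i j => hM.matrix_elem _ _
  -- The first column of an invertible matrix never vanishes, so stable rank one yields a row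
  -- operation making the corner nowhere zero.
  obtain ⟨h, hh, hne⟩ := hX.exists_add_sum_ne_zero (hM.matrix_elem (Sum.inl ()) (Sum.inl ()))
    (c := fun x i => M x (Sum.inr i) (Sum.inl ()))
    (continuous_pi fun i => hM.matrix_elem _ _) (by
      intro x hx hc
      have : (M x).det = 0 := by
        refine Matrix.det_eq_zero_of_column_eq_zero (Sum.inl ()) ?_
        rintro (⟨⟩ | i)
        · exact hx
        · exact congrFun hc i
      rw [hdet] at this
      exact one_ne_zero this)
  have hu : Continuous fun x => (Matrix.of fun (_ : Unit) i => h x i : Matrix Unit ι ℂ) :=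
    continuous_matrix fun _ i => (continuous_apply i).comp hh
  have e : ∀ x, Matrix.fromBlocks 1 (Matrix.of fun (_ : Unit) i => h x i : Matrix Unit ι ℂ) 0 1 *
      M x = Matrix.fromBlocks
        ((M x).toBlocks₁₁ + (Matrix.of fun (_ : Unit) i => h x i) * (M x).toBlocks₂₁)
        ((M x).toBlocks₁₂ + (Matrix.of fun (_ : Unit) i => h x i) * (M x).toBlocks₂₂)
        (M x).toBlocks₂₁ (M x).toBlocks₂₂ := fun x => by
    conv_lhs => rw [← Matrix.fromBlocks_toBlocks (M x)]
    simp [Matrix.fromBlocks_multiply]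
  refine (isNullFamily_upper hu).of_mul_left e ?_
  refine s4 _ _ _ _ (hM11.add (hu.matrix_mul hM21)) (hM12.add (hu.matrix_mul hM22)) hM21 hM22
    (fun x => ?_) fun x => ?_
  · simpa [Matrix.toBlocks₁₁, Matrix.toBlocks₂₁, Matrix.mul_apply] using hne x
  · rw [← e, Matrix.det_mul, hdet, Matrix.det_fromBlocks_zero₂₁]; simp

/-- Over a compact space on which nowhere vanishing functions are dense, every continuous family
of complex matrices of determinant one is homotopic to a constant one. -/
theorem isNullFamily_of_det_eq_one [CompactSpace X] (hX : NowhereZeroDense X) :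
    ∀ (n : ℕ) (M : X → Matrix (Fin n) (Fin n) ℂ), Continuous M → (∀ x, (M x).det = 1) →
      IsNullFamily M
  | 0, M, _, _ => ⟨fun _ => 1, continuous_const, fun _ => Matrix.det_one,
      fun _ => rfl, fun _ => Subsingleton.elim _ _⟩
  | 1, M, _, hd => ⟨fun _ => 1, continuous_const, fun _ => Matrix.det_one,
      fun _ => rfl, fun x => by
        ext i j
        have := hd x
        rw [Matrix.det_fin_one] at this
        rw [Subsingleton.elim i 0, Subsingleton.elim j 0, this]; rfl⟩
  | n + 2, M, hM, hd => by
    let e : Unit ⊕ Fin (n + 1) ≃ Fin (n + 2) :=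
      (Equiv.sumComm _ _).trans ((Equiv.optionEquivSumPUnit _).symm.trans (finSuccEquiv _).symm)
    have := (isNullFamily_sum hX (isNullFamily_of_det_eq_one hX (n + 1))
      (M := fun x => Matrix.reindex e.symm e.symm (M x)) (hM.matrix_reindex _ _)
      fun x => by rw [Matrix.det_reindex_self, hd]).reindex e
    simpa using this

theorem nowhereZeroDense_unit : NowhereZeroDense Unit := by
  intro f _ ε hε
  by_cases h : f () = 0
  · refine ⟨fun _ => ((ε / 2 : ℝ) : ℂ), continuous_const, fun _ => ?_, fun _ => ?_⟩
    · exact Complex.ofReal_ne_zero.mpr (half_pos hε).ne'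
    · rw [h, sub_zero, Complex.norm_real, Real.norm_of_nonneg (half_pos hε).le]
      exact half_lt_self hε
  · exact ⟨f, continuous_of_const fun _ _ => rfl, fun _ => h, fun _ => by simpa using hε⟩

/-- Trigonometric polynomials are dense, and each traces a C¹ curve, whose complement in the plane
is dense for dimension reasons. Subtracting a small value that the curve omits leaves no zeros. -/
theorem nowhereZeroDense_circle : NowhereZeroDense (AddCircle (1 : ℝ)) := by
  have : Fact ((0 : ℝ) < 1) := ⟨one_pos⟩
  intro f hf ε hε
  have hdense : (⟨f, hf⟩ : C(AddCircle (1 : ℝ), ℂ)) ∈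
      (Submodule.span ℂ (Set.range (@fourier 1))).topologicalClosure := by
    rw [span_fourier_closure_eq_top]; trivial
  obtain ⟨p, hp, hpf⟩ := Metric.mem_closure_iff.mp hdense (ε / 2) (half_pos hε)
  have hsm : ContDiff ℝ 1 fun t : ℝ => p (t : AddCircle (1 : ℝ)) := by
    clear hpf
    induction hp using Submodule.span_induction with
    | mem x hx =>
      obtain ⟨n, rfl⟩ := hx
      simp only [fourier_coe_apply]
      have : ContDiff ℝ 1 fun t : ℝ => (t : ℂ) := Complex.ofRealCLM.contDiff
      exact ((contDiff_const.mul this).div_const _).cexp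
    | zero => exact contDiff_const
    | add x y _ _ hx hy => exact hx.add hy
    | smul c x _ hx => exact contDiff_const.smul hx
  have hD := hsm.dense_compl_range_of_finrank_lt_finrank (by simp)
  obtain ⟨w, hw, hw2⟩ := hD.exists_dist_lt 0 (half_pos hε)
  refine ⟨fun x => p x - w, p.continuous.sub continuous_const, fun x hx => ?_, fun x => ?_⟩
  · obtain ⟨t, rfl⟩ := QuotientAddGroup.mk_surjective x
    exact hw ⟨t, sub_eq_zero.mp hx⟩
  · have h1 : ‖f x - p x‖ < ε / 2 := by
      rw [← dist_eq_norm]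
      exact (ContinuousMap.dist_apply_le_dist (f := ⟨f, hf⟩) (g := p) x).trans_lt hpf
    rw [dist_zero_left] at hw2
    calc ‖p x - w - f x‖ = ‖(f x - p x) + w‖ := by rw [← norm_neg]; congr 1; ring
      _ ≤ ‖f x - p x‖ + ‖w‖ := norm_add_le _ _
      _ < ε := by linarith

end NullHomotopy

/-! ### Simple connectedness of SL -/

section SimplyConnected

theorem joined_one_SL (n : ℕ) (g : G n) : Joined 1 g := by
  obtain ⟨H, hc, hd, h0, h1⟩ := isNullFamily_of_det_eq_one nowhereZeroDense_unit (n + 1)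
    (fun _ => g.1) continuous_const fun _ => g.2
  refine ⟨⟨⟨fun t => ⟨H (t, ()), hd _⟩, ?_⟩, ?_, ?_⟩⟩
  · exact (hc.comp (by fun_prop)).subtype_mk _
  · exact Subtype.ext (h0 ())
  · exact Subtype.ext (h1 ())

instance pathConnectedSpace_SL (n : ℕ) : PathConnectedSpace (G n) :=
  ⟨⟨1⟩, fun g h => (joined_one_SL n g).symm.trans (joined_one_SL n h)⟩

/-- The group `SL_{n+1}(ℂ)` is simply connected. -/
instance simplyConnectedSpace_SL (n : ℕ) : SimplyConnectedSpace (G n) := by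
  refine simply_connected_iff_loops_nullhomotopic.mpr ⟨inferInstance, fun g γ => ?_⟩
  have : Fact ((0 : ℝ) < 1) := ⟨one_pos⟩
  let f : ℝ → Matrix (Fin (n + 1)) (Fin (n + 1)) ℂ := fun t => (γ.extend t).1
  have hf : Continuous f := continuous_subtype_val.comp γ.continuous_extend
  have hf01 : f 0 = f (0 + 1) := by simp [f]
  let M : AddCircle (1 : ℝ) → Matrix (Fin (n + 1)) (Fin (n + 1)) ℂ := AddCircle.liftIco 1 0 f
  have hM : Continuous M := AddCircle.liftIco_continuous hf01 hf.continuousOn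
  have hMf : ∀ t : I, M ((t : ℝ) : AddCircle (1 : ℝ)) = (γ t).1 := by
    intro t
    rcases lt_or_eq_of_le t.2.2 with h | h
    · change AddCircle.liftIco 1 0 f _ = _
      rw [AddCircle.liftIco_coe_apply ⟨t.2.1, by simpa using h⟩]
      simp [f]
    · have ht : t = 1 := Subtype.ext h
      subst ht
      have : (((1 : I) : ℝ) : AddCircle (1 : ℝ)) = ((0 : ℝ) : AddCircle (1 : ℝ)) := by
        simp
      rw [this]
      change AddCircle.liftIco 1 0 f _ = _
      rw [AddCircle.liftIco_coe_apply ⟨le_rfl, by simp⟩]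
      simp [f]
  have hdet : ∀ x, (M x).det = 1 := by
    intro x
    obtain ⟨t, ht, rfl⟩ : x ∈ ((↑) : ℝ → AddCircle (1 : ℝ)) '' Set.Icc 0 (0 + 1) := by
      rw [AddCircle.coe_image_Icc_eq]; trivial
    have := hMf ⟨t, by simpa using ht⟩
    simp only at this
    rw [this]
    exact (γ _).2
  obtain ⟨H, hc, hd, h0, h1⟩ := isNullFamily_of_det_eq_one nowhereZeroDense_circle (n + 1)
    M hM hdet
  let K : I × AddCircle (1 : ℝ) → G n := fun p => ⟨H p, hd p⟩
  have hK : Continuous K := hc.subtype_mk _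
  have hK0 : ∀ x, K (0, x) = 1 := fun x => Subtype.ext (h0 x)
  have hK1 : ∀ t : I, K (1, ((t : ℝ) : AddCircle (1 : ℝ))) = γ t := fun t =>
    Subtype.ext ((h1 _).trans (hMf t))
  have hend : (((1 : I) : ℝ) : AddCircle (1 : ℝ)) = (((0 : I) : ℝ) : AddCircle (1 : ℝ)) := by simp
  -- `K` is only a free homotopy; left translation by g K(s,0)⁻¹ holds the base point at g
  -- throughout.
  refine Path.Homotopic.symm ⟨⟨⟨⟨fun p => g * (K (p.1, ((0 : I) : ℝ)))⁻¹ * K (p.1, (p.2 : ℝ)), ?_⟩,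
    fun t => ?_, fun t => ?_⟩, fun s t ht => ?_⟩⟩
  · have hcoe : Continuous fun p : I × I => (((p.2 : I) : ℝ) : AddCircle (1 : ℝ)) :=
      (AddCircle.continuous_mk' 1).comp (by fun_prop)
    exact (continuous_const.mul (hK.comp (by fun_prop)).inv).mul
      (hK.comp (continuous_fst.prodMk hcoe))
  · simp [hK0]
  · simp only [hK1]; simp
  · rcases ht with rfl | ht
    · simp
    · rw [Set.mem_singleton_iff] at ht
      subst ht
      change g * (K (s, _))⁻¹ * K (s, (((1 : I) : ℝ) : AddCircle (1 : ℝ))) = g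
      rw [hend, inv_mul_cancel_right]

end SimplyConnected

open scoped unitInterval Topology

/-! ### Fundamental groups of homogeneous spaces -/

section Homogeneous

variable {Γ O : Type*} [Group Γ] [TopologicalSpace Γ] [IsTopologicalGroup Γ] [TopologicalSpace O]

/-- `π : Γ → O` is the orbit map of a homogeneous space of `Γ` with stabilizer `C`, and it has
continuous local sections. -/
structure IsOrbitMap (π : Γ → O) (C : Subgroup Γ) : Prop where
  continuous : Continuous π
  eq_iff : ∀ g h, π g = π h ↔ g⁻¹ * h ∈ C
  exists_section : ∀ y, ∃ U : Set O, IsOpen U ∧ y ∈ U ∧ ∃ s : O → Γ,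
    ContinuousOn s U ∧ ∀ z ∈ U, π (s z) = z

variable {π : Γ → O} {C : Subgroup Γ}

omit [IsTopologicalGroup Γ] in
theorem IsOrbitMap.map_mul (hπ : IsOrbitMap π C) (g : Γ) {c : Γ} (hc : c ∈ C) :
    π (g * c) = π g :=
  ((hπ.eq_iff _ _).mpr (by rwa [inv_mul_cancel_left])).symm

omit [IsTopologicalGroup Γ] in
-- On the domain of a local section s, a set S coincides with the preimage under s of π⁻¹(S).
theorem IsOrbitMap.isQuotientMap (hπ : IsOrbitMap π C) : Topology.IsQuotientMap π := by
  refine ⟨.of_isOpen_preimage_iff_isOpen fun S =>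
    ⟨fun h => ?_, fun h => h.preimage hπ.continuous⟩, fun y => ?_⟩
  · refine isOpen_iff_mem_nhds.mpr fun y hyS => ?_
    obtain ⟨U, hU, hy, s, hsc, hs⟩ := hπ.exists_section y
    have h1 : IsOpen (U ∩ s ⁻¹' (π ⁻¹' S)) := hsc.isOpen_inter_preimage hU h
    refine Filter.mem_of_superset (h1.mem_nhds ⟨hy, by simpa [hs y hy] using hyS⟩) ?_
    rintro z ⟨hzU, hz⟩
    simpa [hs z hzU] using hz
  · obtain ⟨U, -, hy, s, -, hs⟩ := hπ.exists_section y
    exact ⟨s y, hs y hy⟩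

/-- Path lifting for orbit maps. -/
theorem IsOrbitMap.exists_path_lift (hπ : IsOrbitMap π C) (γ : C(I, O)) (g₀ : Γ)
    (h₀ : γ 0 = π g₀) : ∃ L : C(I, Γ), (∀ t, π (L t) = γ t) ∧ L 0 = g₀ := by
  choose U hUo hyU s hsc hs using hπ.exists_section
  obtain ⟨t, t_0, t_mono, ⟨n_max, h_max⟩, t_sub⟩ :=
    exists_monotone_Icc_subset_open_cover_unitInterval
    (fun y => (hUo y).preimage γ.continuous) fun t _ => Set.mem_iUnion.2 ⟨γ t, hyU _⟩
  suffices ∀ n, ∃ L : I → Γ, ContinuousOn L (Set.Icc 0 (t n)) ∧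
      (∀ u ∈ Set.Icc 0 (t n), π (L u) = γ u) ∧ L 0 = g₀ by
    obtain ⟨L, cont, eqOn, L_0⟩ := this n_max
    rw [h_max _ le_rfl] at cont eqOn
    exact ⟨⟨L, continuousOn_univ.mp
      (by convert! cont; rw [eq_comm, Set.eq_univ_iff_forall]; exact fun t => ⟨bot_le, le_top⟩)⟩,
      fun u => eqOn u ⟨bot_le, le_top⟩, L_0⟩
  intro n
  induction n with
  | zero =>
    refine ⟨fun _ => g₀, continuous_const.continuousOn, fun u hu => ?_, rfl⟩
    rw [t_0, Set.Icc_self, Set.mem_singleton_iff] at hu; subst hu; exact h₀.symm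
  | succ n ih =>
    obtain ⟨L, cont, eqOn, L_0⟩ := ih
    obtain ⟨y, t_sub⟩ := t_sub n
    have hLt : π (L (t n)) = γ (t n) := eqOn _ ⟨t_0 ▸ t_mono n.zero_le, le_rfl⟩
    have htU : γ (t n) ∈ U y := t_sub ⟨le_rfl, t_mono n.le_succ⟩
    have hc : (s y (γ (t n)))⁻¹ * L (t n) ∈ C :=
      (hπ.eq_iff _ _).mp ((hs y _ htU).trans hLt.symm)
    -- The next piece is the local section, multiplied on the right by the constant element of C
    -- that makes it agree with the lift at `t n`.
    refine ⟨fun u => if u ≤ t n then L u else s y (γ u) * ((s y (γ (t n)))⁻¹ * L (t n)),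
      .if (fun u hu => ?_) (cont.mono fun _ h => ?_) ?_, fun u hu => ?_, ?_⟩
    · cases frontier_Iic_subset _ hu.2
      rw [mul_inv_cancel_left]
    · rw [closure_le_eq continuous_id' continuous_const] at h; exact ⟨h.1.1, h.2⟩
    · refine ContinuousOn.mul ((hsc y).comp γ.continuous.continuousOn fun u h => ?_)
        continuousOn_const
      simp_rw [not_le] at h
      exact t_sub ⟨closure_lt_subset_le continuous_const continuous_subtype_val h.2, h.1.2⟩
    · dsimp only
      split_ifs with h
      · exact eqOn u ⟨hu.1, h⟩
      · rw [hπ.map_mul _ hc]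
        exact hs y _ (t_sub ⟨le_of_not_ge h, hu.2⟩)
    · dsimp only; rwa [if_pos (t_0 ▸ t_mono n.zero_le)]

variable {D : Type*} [CommGroup D] {C₀ : Subgroup Γ} {φ : D →* Γ} {D₀ : Subgroup D}

/-- A group of central elements of `Γ` acts on `Γ / C₀` through its quotient by the elements
of `C₀`. -/
abbrev centralAction (hcen : ∀ d g, φ d * g = g * φ d) (hD : ∀ d, d ∈ D₀ ↔ φ d ∈ C₀) :
    MulAction (D ⧸ D₀) (Γ ⧸ C₀) :=
  MulAction.compHom (Γ ⧸ C₀) (QuotientGroup.lift D₀ ((MulAction.toPermHom Γ (Γ ⧸ C₀)).comp φ)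
    fun d hd => by
      ext e
      obtain ⟨g, rfl⟩ := QuotientGroup.mk_surjective e
      change ((φ d * g : Γ) : Γ ⧸ C₀) = g
      rw [hcen, QuotientGroup.mk_mul_of_mem _ ((hD d).mp hd)])

/-- The fundamental group of a homogeneous space `O = Γ / C` of a simply connected group `Γ`, if
the subgroup `C₀` of `C` is open in `C` and path connected, and if `C` is generated by `C₀` and by
central elements of `Γ`. -/
theorem IsOrbitMap.nonempty_fundamentalGroup_mulEquiv [SimplyConnectedSpace Γ]
    (hπ : IsOrbitMap π C) (hcen : ∀ d g, φ d * g = g * φ d) (hD : ∀ d, d ∈ D₀ ↔ φ d ∈ C₀)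
    (hC₀ : C₀ ≤ C) (hφ : ∀ d, φ d ∈ C) (hCφ : ∀ c ∈ C, ∃ d, φ d * c ∈ C₀)
    (hopen : ∃ V ∈ 𝓝 (1 : Γ), ∀ c ∈ C, c ∈ V → c ∈ C₀)
    (hpath : ∀ c ∈ C₀, JoinedIn (C₀ : Set Γ) 1 c) (y : O) :
    Nonempty (D ⧸ D₀ ≃* FundamentalGroup O y) := by
  let act := centralAction hcen hD
  have hact : ∀ (d : D) (g : Γ), (d : D ⧸ D₀) • (g : Γ ⧸ C₀) = ((φ d * g : Γ) : Γ ⧸ C₀) :=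
    fun _ _ => rfl
  let p : Γ ⧸ C₀ → O := Quotient.lift π fun g h hgh =>
    (hπ.eq_iff g h).mpr (hC₀ (QuotientGroup.leftRel_apply.mp hgh))
  have hpmk : ∀ g : Γ, p (g : Γ ⧸ C₀) = π g := fun _ => rfl
  have hpc : Continuous p := continuous_coinduced_dom.mpr hπ.continuous
  have hmkc : Continuous ((↑) : Γ → Γ ⧸ C₀) := QuotientGroup.continuous_mk
  have hcov : IsQuotientCoveringMap p (D ⧸ D₀) := by
    refine
      { toIsQuotientMap := .of_comp (f := ((↑) : Γ → Γ ⧸ C₀)) hmkc hpc hπ.isQuotientMap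
        toContinuousConstSMul := ⟨fun d => ?_⟩
        apply_eq_iff_mem_orbit := fun {e₁ e₂} => ?_
        disjoint := fun e => ?_ }
    · obtain ⟨d, rfl⟩ := QuotientGroup.mk_surjective d
      exact continuous_const_smul (φ d)
    · obtain ⟨g, rfl⟩ := QuotientGroup.mk_surjective e₁
      obtain ⟨h, rfl⟩ := QuotientGroup.mk_surjective e₂
      rw [hpmk, hpmk, hπ.eq_iff]
      constructor
      · intro hgh
        obtain ⟨d, hd⟩ := hCφ _ hgh
        refine ⟨(d : D ⧸ D₀), ?_⟩
        change (d : D ⧸ D₀) • (h : Γ ⧸ C₀) = g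
        rwa [hact, eq_comm, QuotientGroup.eq, ← mul_assoc, ← hcen, mul_assoc]
      · rintro ⟨d, hd⟩
        obtain ⟨d, rfl⟩ := QuotientGroup.mk_surjective d
        change (d : D ⧸ D₀) • (h : Γ ⧸ C₀) = g at hd
        rw [hact, QuotientGroup.eq] at hd
        have h1 := C.inv_mem (hC₀ hd)
        rw [mul_inv_rev, inv_inv, hcen, ← mul_assoc] at h1
        have h2 := C.mul_mem h1 (C.inv_mem (hφ d))
        rwa [mul_inv_cancel_right] at h2
    · obtain ⟨g, rfl⟩ := QuotientGroup.mk_surjective e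
      obtain ⟨V, hV, hVC⟩ := hopen
      have hdiv : Filter.Tendsto (fun q : Γ × Γ => q.1⁻¹ * q.2) (𝓝 (1, 1)) (𝓝 1) := by
        have : Continuous fun q : Γ × Γ => q.1⁻¹ * q.2 := by fun_prop
        simpa using this.tendsto (1, 1)
      have hV2 := hdiv hV
      rw [nhds_prod_eq, Filter.mem_map, Filter.mem_prod_same_iff] at hV2
      obtain ⟨V', hV', hVV⟩ := hV2
      -- If this neighbourhood meets its translate by d, then w⁻¹v φ(d) ∈ C₀ for some v, w ∈ V'.
      -- Hence w⁻¹v lies in C ∩ V, so in C₀, and d is trivial.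
      refine ⟨((↑) : Γ → Γ ⧸ C₀) '' ((g * ·) '' V'), ?_, fun d => ?_⟩
      · refine QuotientGroup.isOpenMap_coe.image_mem_nhds ?_
        have := (isOpenMap_mul_left g).image_mem_nhds hV'
        simpa using this
      · obtain ⟨d, rfl⟩ := QuotientGroup.mk_surjective d
        rintro ⟨-, ⟨-, ⟨-, ⟨v, hv, rfl⟩, rfl⟩, rfl⟩, -, ⟨w, hw, rfl⟩, hvw⟩
        change ((g * w : Γ) : Γ ⧸ C₀) = (d : D ⧸ D₀) • ((g * v : Γ) : Γ ⧸ C₀) at hvw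
        rw [hact, QuotientGroup.eq, hcen] at hvw
        have h1 : (g * w)⁻¹ * (g * v * φ d) = (w⁻¹ * v) * φ d := by group
        rw [h1] at hvw
        have h2 : w⁻¹ * v ∈ C := by
          have := C.mul_mem (hC₀ hvw) (C.inv_mem (hφ d))
          rwa [mul_inv_cancel_right] at this
        have h3 : w⁻¹ * v ∈ C₀ := hVC _ h2 (hVV (Set.mk_mem_prod hw hv))
        rw [QuotientGroup.eq_one_iff, hD]
        exact (C₀.mul_mem_cancel_left h3).mp hvw
  -- A loop lifts to a path in Γ whose ends lie in one coset of C₀. That path is homotopic in Γ to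
  -- one inside the coset, which projects to a constant.
  have hsc : SimplyConnectedSpace (Γ ⧸ C₀) := by
    refine simply_connected_iff_loops_nullhomotopic.mpr
      ⟨QuotientGroup.mk_surjective.pathConnectedSpace hmkc, fun e γ => ?_⟩
    obtain ⟨g₀, rfl⟩ := QuotientGroup.mk_surjective e
    obtain ⟨L, hL, hL0⟩ := hπ.exists_path_lift ((⟨p, hpc⟩ : C(_, _)).comp γ.toContinuousMap) g₀
      (by simp [hpmk])
    -- The lift was taken only through π; unique lifting along the covering `p` shows that it lies
    -- over γ itself.
    have hLγ : (fun t => ((L t : Γ) : Γ ⧸ C₀)) = γ :=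
      hcov.isCoveringMap.eq_of_comp_eq (hmkc.comp L.continuous) γ.continuous
        (funext fun t => hL t) 0 (by simp [hL0])
    have hc : (L 1)⁻¹ * g₀ ∈ C₀ := by
      rw [← QuotientGroup.eq]
      exact (congrFun hLγ 1).trans γ.target
    obtain ⟨β, hβ⟩ := hpath _ hc
    let L' : Path g₀ (L 1) := ⟨L, hL0, rfl⟩
    let β' : Path g₀ (L 1) := ⟨⟨fun t => L 1 * β.symm t, by fun_prop⟩, by simp, by simp⟩
    obtain ⟨F⟩ := SimplyConnectedSpace.paths_homotopic L' β'
    have hβ' : ∀ t, ((L 1 * β.symm t : Γ) : Γ ⧸ C₀) = g₀ := fun t => by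
      have h1 : ((L 1 * β.symm t : Γ) : Γ ⧸ C₀) = ((L 1 : Γ) : Γ ⧸ C₀) :=
        QuotientGroup.mk_mul_of_mem _ (hβ _)
      rw [h1]
      exact QuotientGroup.eq.mpr hc
    refine ⟨⟨⟨⟨fun q => ((F q : Γ) : Γ ⧸ C₀), hmkc.comp F.continuous⟩, fun t => ?_,
      fun t => ?_⟩, fun s t ht => ?_⟩⟩
    · change ((F (0, t) : Γ) : Γ ⧸ C₀) = γ t
      rw [F.apply_zero]; exact congrFun hLγ t
    · change ((F (1, t) : Γ) : Γ ⧸ C₀) = g₀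
      rw [F.apply_one]; exact hβ' t
    · change ((F (s, t) : Γ) : Γ ⧸ C₀) = γ t
      rw [F.eq_fst s ht]; exact congrFun hLγ t
  obtain ⟨e, he⟩ := hcov.surjective y
  -- The covering identifies the fundamental group with the opposite of the deck group;
  -- commutativity removes the opposite.
  let f : D ⧸ D₀ ≃* (D ⧸ D₀)ᵐᵒᵖ :=
    { MulOpposite.opEquiv with
      map_mul' := fun a b => by
        change MulOpposite.op (a * b) = MulOpposite.op a * MulOpposite.op b
        rw [← MulOpposite.op_mul, mul_comm] }
  exact ⟨f.trans (hcov.fundamentalGroupEquiv ⟨e, he⟩).symm⟩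

end Homogeneous

open scoped unitInterval Topology Kronecker

/-! ### Local sections of the orbit map of a nilpotent matrix -/

section LocalSection

/-- Every matrix over a field has a reflexive generalized inverse. -/
theorem exists_generalizedInverse {K κ : Type*} [Field K] [Fintype κ] [DecidableEq κ]
    (A : Matrix κ κ K) : ∃ Q : Matrix κ κ K, A * Q * A = A ∧ Q * A * Q = Q := by
  let f := A.toLin'
  obtain ⟨g₀, hg₀⟩ := f.rangeRestrict.exists_rightInverse_of_surjective f.range_rangeRestrict
  obtain ⟨g, hg⟩ := g₀.exists_extend
  have h1 : f ∘ₗ g ∘ₗ f = f := by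
    refine LinearMap.ext fun v => ?_
    have h2 : g (f v) = g₀ (f.rangeRestrict v) := LinearMap.congr_fun hg (f.rangeRestrict v)
    have h3 := congrArg Subtype.val (LinearMap.congr_fun hg₀ (f.rangeRestrict v))
    change f (g (f v)) = f v
    rw [h2]
    exact h3
  set Q₀ := LinearMap.toMatrix' g
  have h4 : A * Q₀ * A = A := by
    have := congrArg LinearMap.toMatrix' h1
    rwa [LinearMap.toMatrix'_comp, LinearMap.toMatrix'_comp, LinearMap.toMatrix'_toLin',
      ← Matrix.mul_assoc] at this
  refine ⟨Q₀ * A * Q₀, ?_, ?_⟩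
  · calc A * (Q₀ * A * Q₀) * A = (A * Q₀ * A) * Q₀ * A := by simp only [Matrix.mul_assoc]
      _ = A := by rw [h4, h4]
  · calc Q₀ * A * Q₀ * A * (Q₀ * A * Q₀) = Q₀ * (A * Q₀ * A) * Q₀ * A * Q₀ := by
          simp only [Matrix.mul_assoc]
      _ = Q₀ * (A * Q₀ * A) * Q₀ := by simp only [h4, Matrix.mul_assoc]
      _ = Q₀ * A * Q₀ := by rw [h4]

/-- The kernels of a continuous family of matrices of constant rank admit local sections through
any given vector. -/
theorem exists_kernel_section {Y κ : Type*} [TopologicalSpace Y] [Fintype κ] [DecidableEq κ]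
    {A : Y → Matrix κ κ ℂ} (hA : Continuous A) {y₀ : Y} (hr : ∀ y, (A y).rank = (A y₀).rank)
    {v : κ → ℂ} (hv : (A y₀).mulVec v = 0) :
    ∃ U : Set Y, IsOpen U ∧ y₀ ∈ U ∧ ∃ w : Y → κ → ℂ, ContinuousOn w U ∧ w y₀ = v ∧
      ∀ y ∈ U, (A y).mulVec (w y) = 0 := by
  obtain ⟨Q, hQ1, hQ2⟩ := exists_generalizedInverse (A y₀)
  set P := Q * A y₀ with hP
  have hPP : P * P = P := by rw [hP, ← Matrix.mul_assoc, hQ2]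
  -- `M` is the identity at y₀ and satisfies P·M(y) = Q·A(y). So M(y)⁻¹v is killed by Q·A(y),
  -- because Pv = 0.
  let M : Y → Matrix κ κ ℂ := fun y => Q * A y + 1 - P
  have hM : Continuous M := ((continuous_const.matrix_mul hA).add continuous_const).sub
    continuous_const
  have hM0 : M y₀ = 1 := by simp only [M, ← hP]; abel
  have hPM : ∀ y, P * M y = Q * A y := fun y => by
    simp only [M, Matrix.mul_sub, Matrix.mul_add, hPP, Matrix.mul_one, ← Matrix.mul_assoc, hQ2]
    abel
  have hU : IsOpen {y | (M y).det ≠ 0} := isOpen_ne.preimage hM.matrix_det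
  have hunit : ∀ y ∈ {y | (M y).det ≠ 0}, IsUnit (M y).det := fun y hy => isUnit_iff_ne_zero.mpr hy
  refine ⟨{y | (M y).det ≠ 0}, hU, by simp [hM0], fun y => (M y)⁻¹.mulVec v, ?_, by simp [hM0],
    fun y hy => ?_⟩
  · have : ContinuousOn (fun y => (M y)⁻¹) {y | (M y).det ≠ 0} := by
      simp only [Matrix.inv_def, Ring.inverse_eq_inv']
      exact (hM.matrix_det.continuousOn.inv₀ fun y hy => hy).smul hM.matrix_adjugate.continuousOn
    have h2 : Continuous fun B : Matrix κ κ ℂ => B.mulVec v :=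
      continuous_id.matrix_mulVec continuous_const
    exact h2.comp_continuousOn this
  · set w := (M y)⁻¹.mulVec v with hw
    have h1 : (M y).mulVec w = v := by
      rw [hw, Matrix.mulVec_mulVec, Matrix.mul_nonsing_inv _ (hunit y hy), Matrix.one_mulVec]
    have h2 : (Q * A y).mulVec w = 0 := by
      rw [← hPM, ← Matrix.mulVec_mulVec, h1, hP, ← Matrix.mulVec_mulVec, hv, Matrix.mulVec_zero]
    -- Constancy of the rank enters here: it makes the kernels of Q·A(y) and A(y) coincide.
    have h3 : (Q * A y).rank = (A y).rank := by
      rw [hr y, ← hPM, Matrix.rank_mul_eq_left_of_isUnit_det _ _ (hunit y hy)]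
      refine le_antisymm (Matrix.rank_mul_le_right _ _) ?_
      conv_lhs => rw [← hQ1, Matrix.mul_assoc]
      exact Matrix.rank_mul_le_right _ _
    have h4 : LinearMap.ker (A y).mulVecLin = LinearMap.ker (Q * A y).mulVecLin := by
      refine Submodule.eq_of_le_of_finrank_eq (fun u hu => ?_) ?_
      · rw [LinearMap.mem_ker, Matrix.mulVecLin_apply] at hu ⊢
        rw [← Matrix.mulVec_mulVec, hu, Matrix.mulVec_zero]
      · have e1 := (A y).mulVecLin.finrank_range_add_finrank_ker
        have e2 := (Q * A y).mulVecLin.finrank_range_add_finrank_ker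
        rw [Matrix.rank, Matrix.rank] at h3
        omega
    have h5 : w ∈ LinearMap.ker (A y).mulVecLin := by rw [h4]; exact h2
    exact h5

variable {n : ℕ} (x : nilradical n)

/-- The orbit map of the conjugation action of `SL_{n+1}(ℂ)`. -/
def orbitMap (g : G n) : nilpotentOrbit n x := ⟨g.1 * x.1 * (g⁻¹).1, g, rfl⟩

/-- The stabilizer of the base point for the conjugation action. -/
def slCentralizer : Subgroup (G n) where
  carrier := {g | g.1 * x.1 = x.1 * g.1}
  one_mem' := by simp
  mul_mem' {g h} hg hh := by
    change g.1 * x.1 = x.1 * g.1 at hg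
    change h.1 * x.1 = x.1 * h.1 at hh
    change (g * h).1 * x.1 = x.1 * (g * h).1
    rw [Matrix.SpecialLinearGroup.coe_mul, Matrix.mul_assoc, hh, ← Matrix.mul_assoc, hg,
      Matrix.mul_assoc]
  inv_mem' {g} hg := by
    change g.1 * x.1 = x.1 * g.1 at hg
    change (g⁻¹).1 * x.1 = x.1 * (g⁻¹).1
    have h1 : g.1 * (g⁻¹).1 = 1 := by
      rw [← Matrix.SpecialLinearGroup.coe_mul, mul_inv_cancel, Matrix.SpecialLinearGroup.coe_one]
    have h2 : (g⁻¹).1 * g.1 = 1 := by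
      rw [← Matrix.SpecialLinearGroup.coe_mul, inv_mul_cancel, Matrix.SpecialLinearGroup.coe_one]
    calc (g⁻¹).1 * x.1 = (g⁻¹).1 * (x.1 * g.1) * (g⁻¹).1 := by
          rw [Matrix.mul_assoc, Matrix.mul_assoc, h1, Matrix.mul_one]
      _ = x.1 * (g⁻¹).1 := by rw [← hg, ← Matrix.mul_assoc, h2, Matrix.one_mul]

theorem mem_slCentralizer {x : nilradical n} {g : G n} :
    g ∈ slCentralizer x ↔ g.1 * x.1 = x.1 * g.1 := Iff.rfl

theorem SL_mul_inv (g : G n) : g.1 * (g⁻¹).1 = 1 := by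
  rw [← Matrix.SpecialLinearGroup.coe_mul, mul_inv_cancel, Matrix.SpecialLinearGroup.coe_one]

theorem SL_inv_mul (g : G n) : (g⁻¹).1 * g.1 = 1 := by
  rw [← Matrix.SpecialLinearGroup.coe_mul, inv_mul_cancel, Matrix.SpecialLinearGroup.coe_one]

theorem SL_conj_eq_iff (g : G n) (a b : Matrix (Fin (n + 1)) (Fin (n + 1)) ℂ) :
    g.1 * a * (g⁻¹).1 = b ↔ g.1 * a = b * g.1 := by
  constructor
  · rintro rfl
    rw [Matrix.mul_assoc, SL_inv_mul, Matrix.mul_one]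
  · intro h
    rw [h, Matrix.mul_assoc, SL_mul_inv, Matrix.mul_one]

/-- Near the base point, the points of an orbit are conjugate to it by matrices of determinant one
that depend continuously on the point. -/
theorem exists_section_base : ∃ U : Set (nilpotentOrbit n x), IsOpen U ∧
    (⟨x.1, mem_nilpotentOrbit n x⟩ : nilpotentOrbit n x) ∈ U ∧
    ∃ s : nilpotentOrbit n x → G n, ContinuousOn s U ∧ ∀ z ∈ U, orbitMap x (s z) = z := by
  let y₀ : nilpotentOrbit n x := ⟨x.1, mem_nilpotentOrbit n x⟩
  -- The matrix of T ↦ Tx - yT on vectorized matrices: its kernel consists of the intertwiners from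
  -- x to y. Its rank is constant because y stays in one conjugacy class.
  let A : nilpotentOrbit n x → Matrix (Fin (n + 1) × Fin (n + 1)) (Fin (n + 1) × Fin (n + 1)) ℂ :=
    fun y => x.1.transpose ⊗ₖ 1 - 1 ⊗ₖ y.1
  have hAv : ∀ y (T : Matrix (Fin (n + 1)) (Fin (n + 1)) ℂ),
      (A y).mulVec T.vec = (T * x.1 - y.1 * T).vec := fun y T => by
    simp only [A, Matrix.sub_mulVec, Matrix.kronecker_mulVec_vec, Matrix.vec_sub]
    simp
  have hA : Continuous A := by
    refine continuous_const.sub (continuous_matrix fun i j => ?_)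
    simp only [Matrix.kroneckerMap_apply]
    exact continuous_const.mul (continuous_subtype_val.matrix_elem _ _)
  have hr : ∀ y, (A y).rank = (A y₀).rank := by
    rintro ⟨-, g, rfl⟩
    have e : A ⟨_, g, rfl⟩ = (1 ⊗ₖ g.1) * A y₀ * (1 ⊗ₖ (g⁻¹).1) := by
      simp only [A, y₀, Matrix.mul_sub, Matrix.sub_mul, ← Matrix.mul_kronecker_mul, Matrix.one_mul,
        Matrix.mul_one, SL_mul_inv]
    have hd : ∀ h : G n, IsUnit ((1 : Matrix (Fin (n + 1)) (Fin (n + 1)) ℂ) ⊗ₖ h.1).det := fun h => by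
      rw [Matrix.det_kronecker, h.2]; simp
    rw [e, Matrix.rank_mul_eq_left_of_isUnit_det _ _ (hd _),
      Matrix.rank_mul_eq_right_of_isUnit_det _ _ (hd _)]
  obtain ⟨U, hU, hyU, w, hwc, hw0, hw⟩ := exists_kernel_section hA hr
    (v := (1 : Matrix (Fin (n + 1)) (Fin (n + 1)) ℂ).vec) (by
      rw [hAv]; simp [y₀])
  let T : nilpotentOrbit n x → Matrix (Fin (n + 1)) (Fin (n + 1)) ℂ :=
    fun y => Matrix.of fun i j => w y (j, i)
  have hTv : ∀ y, (T y).vec = w y := fun y => rfl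
  have hTc : ContinuousOn T U := by
    refine continuousOn_pi.mpr fun i => continuousOn_pi.mpr fun j => ?_
    exact (continuous_apply (j, i)).comp_continuousOn hwc
  have hT0 : T y₀ = 1 := by rw [← Matrix.vec_inj, hTv, hw0]
  have hT : ∀ y ∈ U, T y * x.1 = y.1 * T y := fun y hy => by
    have := hw y hy
    rw [← hTv, hAv, Matrix.vec_eq_zero_iff] at this
    exact sub_eq_zero.mp this
  have hdet : ContinuousOn (fun y => (T y).det) U :=
    (continuous_id.matrix_det (n := Fin (n + 1)) (R := ℂ)).comp_continuousOn hTc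
  -- A branch of d^(-1/(n+1)), continuous on the slit plane, rescales the intertwiner to determinant
  -- 1.
  let κ : ℂ → ℂ := fun d => Complex.exp (-(Complex.log d / ((n + 1 : ℕ) : ℂ)))
  have hn : ((n + 1 : ℕ) : ℂ) ≠ 0 := by exact_mod_cast n.succ_ne_zero
  have hκ : ∀ d : ℂ, d ≠ 0 → κ d ^ (n + 1) * d = 1 := fun d hd => by
    have h1 : κ d ^ (n + 1) = d⁻¹ := by
      rw [← Complex.exp_nat_mul, mul_neg, mul_div_cancel₀ _ hn, Complex.exp_neg, Complex.exp_log hd]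
    rw [h1, inv_mul_cancel₀ hd]
  have hdT : ∀ y, (T y).det ≠ 0 → (κ (T y).det • T y).det = 1 := fun y hy => by
    rw [Matrix.det_smul, Fintype.card_fin, hκ _ hy]
  let s : nilpotentOrbit n x → G n := fun y =>
    if h : (T y).det ≠ 0 then ⟨κ (T y).det • T y, hdT y h⟩ else 1
  have hs : ∀ y, (T y).det ≠ 0 → (s y).1 = κ (T y).det • T y := fun y hy => by
    rw [show s y = ⟨κ (T y).det • T y, hdT y hy⟩ from dif_pos hy]
  refine ⟨U ∩ (fun y => (T y).det) ⁻¹' Complex.slitPlane,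
    hdet.isOpen_inter_preimage hU Complex.isOpen_slitPlane, ⟨hyU, ?_⟩, s, ?_, ?_⟩
  · change (T y₀).det ∈ Complex.slitPlane
    rw [hT0, Matrix.det_one]; exact Complex.one_mem_slitPlane
  · refine Topology.IsInducing.subtypeVal.continuousOn_iff.mpr ?_
    refine ContinuousOn.congr (f := fun y => κ (T y).det • T y) ?_ fun y hy =>
      hs y (Complex.slitPlane_ne_zero hy.2)
    refine ContinuousOn.smul (f := fun y => κ (T y).det) (g := T) ?_ (hTc.mono Set.inter_subset_left)
    exact Complex.continuous_exp.comp_continuousOn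
      ((((hdet.mono Set.inter_subset_left).clog fun y hy => hy.2).div_const _).neg)
  · rintro y ⟨hyU, hy⟩
    refine Subtype.ext ((SL_conj_eq_iff _ _ _).mpr ?_)
    rw [hs y (Complex.slitPlane_ne_zero hy), Matrix.smul_mul, Matrix.mul_smul, hT y hyU]

theorem orbitMap_eq_iff (g h : G n) : orbitMap x g = orbitMap x h ↔ g⁻¹ * h ∈ slCentralizer x := by
  rw [mem_slCentralizer, Subtype.ext_iff, eq_comm]
  change h.1 * x.1 * (h⁻¹).1 = g.1 * x.1 * (g⁻¹).1 ↔ _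
  rw [SL_conj_eq_iff, Matrix.SpecialLinearGroup.coe_mul]
  constructor
  · intro e
    rw [Matrix.mul_assoc, e]
    simp only [← Matrix.mul_assoc, SL_inv_mul, Matrix.one_mul]
  · intro e
    have := congrArg (g.1 * ·) e
    simpa only [← Matrix.mul_assoc, SL_mul_inv, Matrix.one_mul] using this

theorem isOrbitMap_orbitMap : IsOrbitMap (orbitMap x) (slCentralizer x) where
  continuous := by
    refine Continuous.subtype_mk ?_ _
    exact (continuous_subtype_val.matrix_mul continuous_const).matrix_mul
      (continuous_subtype_val.comp (continuous_inv (G := G n)))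
  eq_iff := orbitMap_eq_iff x
  exists_section := by
    rintro ⟨-, g, rfl⟩
    obtain ⟨U, hU, hxU, s, hsc, hs⟩ := exists_section_base x
    -- Conjugation by g⁻¹ carries the given point to the base point, where a section is available.
    let τ : nilpotentOrbit n x → nilpotentOrbit n x := fun z =>
      ⟨(g⁻¹).1 * z.1 * g.1, by
        obtain ⟨-, h, rfl⟩ := z
        refine ⟨g⁻¹ * h, ?_⟩
        change (g⁻¹ * h).1 * x.1 * ((g⁻¹ * h)⁻¹).1 = _
        rw [mul_inv_rev, inv_inv]
        simp only [Matrix.SpecialLinearGroup.coe_mul, Matrix.mul_assoc]⟩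
    have hτ : Continuous τ := Continuous.subtype_mk
      ((continuous_const.matrix_mul continuous_subtype_val).matrix_mul continuous_const) _
    refine ⟨τ ⁻¹' U, hU.preimage hτ, ?_, fun z => g * s (τ z), ?_, fun z hz => ?_⟩
    · have : τ ⟨_, g, rfl⟩ = ⟨x.1, mem_nilpotentOrbit n x⟩ := by
        refine Subtype.ext ?_
        change (g⁻¹).1 * (g.1 * x.1 * (g⁻¹).1) * g.1 = x.1
        simp only [Matrix.mul_assoc, SL_inv_mul, Matrix.mul_one]
        rw [← Matrix.mul_assoc, SL_inv_mul, Matrix.one_mul]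
      rw [Set.mem_preimage, this]
      exact hxU
    · exact continuousOn_const.mul (hsc.comp hτ.continuousOn fun z hz => hz)
    · have h1 := congrArg Subtype.val (hs _ hz)
      refine Subtype.ext ?_
      change (s (τ z)).1 * x.1 * ((s (τ z))⁻¹).1 = (g⁻¹).1 * z.1 * g.1 at h1
      change (g * s (τ z)).1 * x.1 * ((g * s (τ z))⁻¹).1 = z.1
      rw [SL_conj_eq_iff] at h1 ⊢
      rw [Matrix.SpecialLinearGroup.coe_mul, Matrix.mul_assoc, h1]
      simp only [← Matrix.mul_assoc, SL_mul_inv, Matrix.one_mul]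

end LocalSection

open scoped unitInterval Topology

/-! ### The centre as scalar roots of unity -/

section Centre

variable {n : ℕ}

/-- The scalar by which an element of the centre acts. -/
def scalarOf (z : centre n) : ℂˣ := z.1.1 0

theorem torusToSL_val (t : torus n) : (torusToSL n t).1 = Matrix.diagonal fun i => (t.1 i : ℂ) := rfl

theorem centre_apply (z : centre n) (i : Fin (n + 1)) : z.1.1 i = scalarOf z := by
  have h := Matrix.SpecialLinearGroup.scalar_eq_self_of_mem_center
    (A := torusToSL n z.1) (Subgroup.mem_comap.mp z.2) 0
  have h2 := congrFun (congrFun h i) i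
  refine Units.ext ?_
  change (Matrix.scalar (Fin (n + 1)) (Matrix.diagonal (fun i => (z.1.1 i : ℂ)) 0 0)) i i =
    Matrix.diagonal (fun i => (z.1.1 i : ℂ)) i i at h2
  rw [Matrix.scalar_apply, Matrix.diagonal_apply_eq, Matrix.diagonal_apply_eq,
    Matrix.diagonal_apply_eq] at h2
  exact h2.symm

theorem torusToSL_centre (z : centre n) :
    (torusToSL n z.1).1 = (scalarOf z : ℂ) • (1 : Matrix (Fin (n + 1)) (Fin (n + 1)) ℂ) := by
  rw [torusToSL_val, ← Matrix.diagonal_one, ← Matrix.diagonal_smul]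
  congr 1
  ext i
  simp [centre_apply]

theorem torusToSL_centre_mul (z : centre n) (g : G n) :
    (torusToSL n z.1 * g).1 = (scalarOf z : ℂ) • g.1 := by
  rw [Matrix.SpecialLinearGroup.coe_mul, torusToSL_centre, Matrix.smul_mul, Matrix.one_mul]

theorem torusToSL_centre_comm (z : centre n) (g : G n) :
    torusToSL n z.1 * g = g * torusToSL n z.1 :=
  (Subgroup.mem_center_iff.mp (Subgroup.mem_comap.mp z.2) g).symm

theorem scalarOf_pow (z : centre n) : scalarOf z ^ (n + 1) = 1 := by
  have h : ∏ i, z.1.1 i = 1 := z.1.2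
  simpa [centre_apply] using h

theorem exists_scalarOf_eq (ζ : ℂˣ) (hζ : ζ ^ (n + 1) = 1) : ∃ z : centre n, scalarOf z = ζ := by
  refine ⟨⟨⟨fun _ => ζ, ?_⟩, ?_⟩, rfl⟩
  · change ∏ _i : Fin (n + 1), ζ = 1
    simp [hζ]
  · refine Subgroup.mem_comap.mpr (Matrix.SpecialLinearGroup.mem_center_iff.mpr ⟨(ζ : ℂ), ?_, ?_⟩)
    · rw [Fintype.card_fin, ← Units.val_pow_eq_pow_val, hζ, Units.val_one]
    · rw [torusToSL_val]; rfl

theorem scalarOf_mul (z w : centre n) : scalarOf (z * w) = scalarOf z * scalarOf w := rfl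

end Centre

/-! ### Components of the centralizer and the fundamental group -/

section Pi1

variable {n : ℕ} (x : nilradical n)

/-- The identity component of the centralizer. -/
def centralizerComponent : Subgroup (G n) where
  carrier := {g | JoinedIn (slCentralizer x : Set (G n)) 1 g}
  one_mem' := JoinedIn.refl (one_mem (slCentralizer x))
  mul_mem' {g h} hg hh := by
    refine hg.trans ?_
    obtain ⟨γ, hγ⟩ := hh
    exact ⟨⟨⟨fun t => g * γ t, by fun_prop⟩, by simp, by simp⟩, fun t =>
      (slCentralizer x).mul_mem hg.target_mem (hγ t)⟩
  inv_mem' {g} hg := by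
    obtain ⟨γ, hγ⟩ := hg
    exact ⟨⟨⟨fun t => (γ t)⁻¹, by fun_prop⟩, by simp, by simp⟩, fun t =>
      (slCentralizer x).inv_mem (hγ t)⟩

theorem mem_centralizerComponent {x : nilradical n} {g : G n} :
    g ∈ centralizerComponent x ↔ JoinedIn (slCentralizer x : Set (G n)) 1 g := Iff.rfl

/-- The fundamental group of the orbit of `x`, provided that the centralizer is generated by its
identity component and by the centre, and that a function `δ` on matrices detects the components. -/
theorem nonempty_mulEquiv_orbitPi1 {m : ℕ}
    {δ : Matrix (Fin (n + 1)) (Fin (n + 1)) ℂ → ℂ} (hδ : Continuous δ)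
    (hδ₁ : ∀ g ∈ centralizerComponent x, δ g.1 = 1)
    (hδs : ∀ (ζ : ℂ) A, δ (ζ • A) = ζ ^ m * δ A)
    (hgen : ∀ g ∈ slCentralizer x, ∃ z : centre n, torusToSL n z.1 * g ∈ centralizerComponent x)
    (hcen : ∀ z : centre n, scalarOf z ^ m = 1 → torusToSL n z.1 ∈ centralizerComponent x)
    (D₀ : Subgroup (centre n)) (hD₀ : ∀ z, z ∈ D₀ ↔ scalarOf z ^ m = 1) :
    Nonempty (centre n ⧸ D₀ ≃* orbitPi1 n x) := by
  have hle : centralizerComponent x ≤ slCentralizer x := fun g hg => hg.target_mem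
  have hδ1 : δ 1 = 1 := hδ₁ 1 (one_mem _)
  refine (isOrbitMap_orbitMap x).nonempty_fundamentalGroup_mulEquiv (D := centre n) (D₀ := D₀)
    (C₀ := centralizerComponent x) (φ := (torusToSL n).comp (centre n).subtype)
    torusToSL_centre_comm (fun z => ?_) hle (fun z => ?_) hgen ?_ (fun c hc => ?_) _
  · rw [hD₀]
    refine ⟨hcen z, fun h => ?_⟩
    have h1 := hδ₁ _ h
    change δ (torusToSL n z.1).1 = 1 at h1
    rw [torusToSL_centre, hδs, hδ1, mul_one] at h1
    exact Units.ext (by simpa using h1)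
  · rw [mem_slCentralizer]
    change (torusToSL n z.1).1 * x.1 = x.1 * (torusToSL n z.1).1
    rw [torusToSL_centre]; simp
  -- Writing c ∈ C as a central element times an element of C₀ shows δ(c)^(n+1) = 1. Avoiding the
  -- finite set `S` thus forces δ(c) = 1, which puts the central factor, and hence c, in C₀.
  · let S : Set ℂ := {w | w ^ (n + 1) = 1 ∧ w ≠ 1}
    have hS : S.Finite := by
      refine (Polynomial.nthRoots (n + 1) (1 : ℂ)).toFinset.finite_toSet.subset fun w hw => ?_
      simpa [Polynomial.mem_nthRoots] using hw.1
    refine ⟨{g | δ g.1 ∉ S}, ?_, fun c hc hcV => ?_⟩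
    · refine (hS.isClosed.isOpen_compl.preimage (hδ.comp continuous_subtype_val)).mem_nhds ?_
      change δ 1 ∉ S
      rw [hδ1]
      exact fun h => h.2 rfl
    · obtain ⟨z, hz⟩ := hgen c hc
      have h1 := hδ₁ _ hz
      rw [torusToSL_centre_mul, hδs] at h1
      have h2 : ((scalarOf z : ℂ) ^ m) ^ (n + 1) = 1 := by
        rw [← pow_mul, mul_comm, pow_mul]
        have := congrArg Units.val (scalarOf_pow z)
        rw [Units.val_pow_eq_pow_val, Units.val_one] at this
        rw [this, one_pow]
      have h3 : δ c.1 ^ (n + 1) = 1 := by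
        have := congrArg (· ^ (n + 1)) h1
        simpa [mul_pow, h2] using this
      have h4 : δ c.1 = 1 := by
        by_contra h
        exact hcV ⟨h3, h⟩
      rw [h4, mul_one] at h1
      have h5 : scalarOf z ^ m = 1 := Units.ext (by simpa using h1)
      exact ((centralizerComponent x).mul_mem_cancel_left (hcen z h5)).mp hz
  · exact (isPathConnected_pathComponentIn (one_mem (slCentralizer x))).joinedIn 1
      (one_mem (centralizerComponent x)) c hc

end Pi1

/-! ### Vanishing entries of matrices commuting with the nilpotent -/

section Blocks

/-- The first position of the block of `p`, for the decomposition of `{0, …, N - 1}` into intervals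
beginning at `0` and at the elements of `J`. -/
def blockStart (J : Finset ℕ) : ℕ → ℕ
  | 0 => 0
  | p + 1 => if p + 1 ∈ J then p + 1 else blockStart J p

/-- The first position after the block of `p`. -/
noncomputable def blockEnd (J : Finset ℕ) (N p : ℕ) : ℕ := sInf {d | p < d ∧ (d ∈ J ∨ N ≤ d)}

variable {J : Finset ℕ} {N : ℕ}

theorem blockStart_le (p : ℕ) : blockStart J p ≤ p := by
  induction p with
  | zero => exact le_rfl
  | succ p ih => rw [blockStart]; split_ifs <;> omega

theorem blockStart_mem (p : ℕ) : blockStart J p = 0 ∨ blockStart J p ∈ J := by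
  induction p with
  | zero => exact Or.inl rfl
  | succ p ih => rw [blockStart]; split_ifs with h; exacts [Or.inr h, ih]

theorem blockEnd_spec (p : ℕ) :
    p < blockEnd J N p ∧ (blockEnd J N p ∈ J ∨ N ≤ blockEnd J N p) :=
  Nat.sInf_mem (s := {d | p < d ∧ (d ∈ J ∨ N ≤ d)}) ⟨max (p + 1) N, by simp⟩

theorem blockEnd_le {p d : ℕ} (hp : p < d) (hd : d ∈ J ∨ N ≤ d) : blockEnd J N p ≤ d :=
  Nat.sInf_le ⟨hp, hd⟩

theorem blockEnd_of_cut {p : ℕ} (h : p + 1 ∈ J ∨ N ≤ p + 1) : blockEnd J N p = p + 1 :=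
  le_antisymm (blockEnd_le p.lt_succ_self h) (blockEnd_spec p).1

theorem blockEnd_succ {p : ℕ} (h : p + 1 ∉ J) (hN : p + 1 < N) :
    blockEnd J N (p + 1) = blockEnd J N p := by
  have h1 := blockEnd_spec (J := J) (N := N) p
  have h2 := blockEnd_spec (J := J) (N := N) (p + 1)
  refine le_antisymm (blockEnd_le ?_ h1.2) (blockEnd_le (by omega) h2.2)
  rcases Nat.lt_or_ge (p + 1) (blockEnd J N p) with h3 | h3
  · exact h3
  · have h4 : blockEnd J N p = p + 1 := by omega
    rw [h4] at h1
    rcases h1.2 with h5 | h5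
    · exact (h h5).elim
    · omega

/-- The entries of a matrix that commutes with the nilpotent matrix with blocks given by `J`
vanish below the block diagonal, for the order by position inside the block and, for equal
positions, by decreasing length of the block. -/
theorem entry_eq_zero_of_commute {F : ℕ → ℕ → ℂ}
    (hF : ∀ p < N, ∀ q < N, (if p + 1 < N ∧ p + 1 ∉ J then F (p + 1) q else 0) =
      if 1 ≤ q ∧ q ∉ J then F p (q - 1) else 0) :
    (∀ q < N, ∀ p < N, q - blockStart J q < p - blockStart J p → F p q = 0) ∧
    ∀ k, ∀ p < N, ∀ q < N, blockEnd J N p - p = k → blockEnd J N p - p < blockEnd J N q - q →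
      F p q = 0 := by
  constructor
  -- Moving up and left along the diagonal, the column reaches the start of its block before the row
  -- does, and there the relation gives 0.
  · intro q
    induction q with
    | zero =>
      intro hq p hp hlt
      obtain ⟨p, rfl⟩ : ∃ p', p = p' + 1 := ⟨p - 1, by omega⟩
      have hpJ : p + 1 ∉ J := fun h => by rw [blockStart.eq_2 _ p, if_pos h] at hlt; omega
      have := hF p (by omega) 0 hq
      simpa [hp, hpJ] using this
    | succ q ih =>
      intro hq p hp hlt
      obtain ⟨p, rfl⟩ : ∃ p', p = p' + 1 := ⟨p - 1, by omega⟩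
      have hpJ : p + 1 ∉ J := fun h => by rw [blockStart.eq_2 _ p, if_pos h] at hlt; omega
      have := hF p (by omega) (q + 1) hq
      rw [if_pos ⟨hp, hpJ⟩] at this
      rw [this]
      split_ifs with h
      · rw [blockStart.eq_2 _ p, blockStart.eq_2 _ q, if_neg hpJ, if_neg h.2] at hlt
        have h1 := blockStart_le (J := J) p
        have h2 := blockStart_le (J := J) q
        exact ih (by omega) p (by omega) (by omega)
      · rfl
  -- Moving down and right, the row reaches the end of its block first.
  · intro k
    induction k with
    | zero =>
      intro p hp q hq hk
      have := (blockEnd_spec (J := J) (N := N) p).1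
      omega
    | succ k ih =>
      intro p hp q hq hk hlt
      have hp1 := (blockEnd_spec (J := J) (N := N) p).1
      have hq1 : ¬(q + 1 ∈ J ∨ N ≤ q + 1) := fun h => by
        rw [blockEnd_of_cut h] at hlt; omega
      rw [not_or, not_le] at hq1
      have := hF p hp (q + 1) hq1.2
      rw [if_pos (c := 1 ≤ q + 1 ∧ q + 1 ∉ J) ⟨by omega, hq1.1⟩, Nat.add_sub_cancel] at this
      rw [← this]
      split_ifs with h
      · have e1 := blockEnd_succ h.2 h.1
        have e2 := blockEnd_succ hq1.1 hq1.2
        exact ih (p + 1) h.1 (q + 1) hq1.2 (by omega) (by omega)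
      · rfl

end Blocks

/-! ### A root of the determinant on the commutant -/

section Delta

variable {J : Finset ℕ} {m c N : ℕ}

/-- The bijection `(i, r) ↦ c i + r`. -/
def residueEquiv (h : m * c = N) : Fin m × Fin c ≃ Fin N :=
  finProdFinEquiv.trans (finCongr h)

theorem residueEquiv_val (h : m * c = N) (i : Fin m) (r : Fin c) :
    (residueEquiv h (i, r) : ℕ) = r + c * i := rfl

/-- The nilpotent matrix with ones directly above the diagonal, except in the columns in `J`. -/
def cutNilpotent (J : Finset ℕ) (N : ℕ) : Matrix (Fin N) (Fin N) ℂ :=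
  Matrix.of fun i j => if (j : ℕ) = i + 1 ∧ (j : ℕ) ∉ J then 1 else 0

/-- Extending the entries by zero to indices in ℕ turns commutation into a shift relation suited to
induction. -/
theorem commute_cutNilpotent {N : ℕ} {A : Matrix (Fin N) (Fin N) ℂ}
    (hA : A * cutNilpotent J N = cutNilpotent J N * A) :
    let F : ℕ → ℕ → ℂ := fun p q => if h : p < N ∧ q < N then A ⟨p, h.1⟩ ⟨q, h.2⟩ else 0
    ∀ p < N, ∀ q < N, (if p + 1 < N ∧ p + 1 ∉ J then F (p + 1) q else 0) =
      if 1 ≤ q ∧ q ∉ J then F p (q - 1) else 0 := by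
  intro F p hp q hq
  have h := congrFun (congrFun hA ⟨p, hp⟩) ⟨q, hq⟩
  rw [Matrix.mul_apply, Matrix.mul_apply] at h
  have e1 : ∑ k, cutNilpotent J N ⟨p, hp⟩ k * A k ⟨q, hq⟩ =
      if p + 1 < N ∧ p + 1 ∉ J then F (p + 1) q else 0 := by
    split_ifs with hc
    · rw [Finset.sum_eq_single ⟨p + 1, hc.1⟩]
      · simp [cutNilpotent, hc.2, F, hc.1, hq]
      · intro k _ hk
        have : ¬ ((k : ℕ) = p + 1) := fun h => hk (Fin.ext h)
        simp [cutNilpotent, this]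
      · simp
    · refine Finset.sum_eq_zero fun k _ => ?_
      have : ¬ ((k : ℕ) = p + 1 ∧ (k : ℕ) ∉ J) := by
        rintro ⟨h1, h2⟩
        exact hc ⟨h1 ▸ k.2, h1 ▸ h2⟩
      simp [cutNilpotent, this]
  have e2 : ∑ k, A ⟨p, hp⟩ k * cutNilpotent J N k ⟨q, hq⟩ =
      if 1 ≤ q ∧ q ∉ J then F p (q - 1) else 0 := by
    split_ifs with hc
    · rw [Finset.sum_eq_single ⟨q - 1, by omega⟩]
      · have : q = q - 1 + 1 := by omega
        have h2 : q - 1 < N := by omega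
        simp [cutNilpotent, hc.2, F, hp, h2, ← this]
      · intro k _ hk
        have : ¬ (q = k + 1) := fun h => hk (Fin.ext (by simp; omega))
        simp [cutNilpotent, this]
      · simp
    · refine Finset.sum_eq_zero fun k _ => ?_
      have : ¬ (q = k + 1 ∧ q ∉ J) := by
        rintro ⟨h1, h2⟩
        exact hc ⟨by omega, h2⟩
      simp [cutNilpotent, this]
  rw [← e1, ← e2, h]

/-- The determinant of the submatrix on the indices divisible by `c`. -/
noncomputable def residueDet [NeZero c] (h : m * c = N) (A : Matrix (Fin N) (Fin N) ℂ) : ℂ :=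
  (A.submatrix (fun i => residueEquiv h (i, 0)) fun i => residueEquiv h (i, 0)).det

/-- A is block triangular for the order by position in the block, then by decreasing length. Indices
of equal position agree mod c, as blocks start at multiples of c. So entries joining different
residues can be dropped without changing the determinant, and what remains is a direct sum of c
matrices, one per residue, all equal by the shift relation. -/
theorem residueDet_pow [NeZero c] (h : m * c = N) (hJ : ∀ d ∈ J, c ∣ d) {A : Matrix (Fin N) (Fin N) ℂ}
    (hA : A * cutNilpotent J N = cutNilpotent J N * A) :
    residueDet h A ^ c = A.det := by
  have hc0 : 0 < c := Nat.pos_of_ne_zero (NeZero.ne c)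
  let F : ℕ → ℕ → ℂ := fun p q => if h : p < N ∧ q < N then A ⟨p, h.1⟩ ⟨q, h.2⟩ else 0
  have hFA : ∀ p q : Fin N, F p q = A p q := fun p q => by simp [F]
  have hF : ∀ p < N, ∀ q < N, (if p + 1 < N ∧ p + 1 ∉ J then F (p + 1) q else 0) =
      if 1 ≤ q ∧ q ∉ J then F p (q - 1) else 0 := commute_cutNilpotent hA
  obtain ⟨hz1, hz2⟩ := entry_eq_zero_of_commute hF
  -- Subtracting from N + N reverses the order by distance to the block end.
  let key : Fin N → ℕ ×ₗ ℕ := fun p =>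
    toLex ((p : ℕ) - blockStart J p, N + N - (blockEnd J N p - p))
  have htri : A.BlockTriangular key := by
    intro p q hlt
    rw [← hFA]
    rw [Prod.Lex.lt_iff] at hlt
    rcases hlt with hl | ⟨-, hl⟩
    · exact hz1 q q.2 p p.2 hl
    · refine hz2 _ p p.2 q q.2 rfl ?_
      simp only [key, ofLex_toLex] at hl
      omega
  let A' : Matrix (Fin N) (Fin N) ℂ :=
    Matrix.of fun p q => if (p : ℕ) % c = (q : ℕ) % c then A p q else 0
  have htri' : A'.BlockTriangular key := by
    intro p q hlt
    simp [A', htri hlt]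
  have hmod : ∀ p : ℕ, (p - blockStart J p) % c = p % c := fun p => by
    have h1 : c ∣ blockStart J p := by
      rcases blockStart_mem (J := J) p with hl | hl
      · rw [hl]; exact dvd_zero c
      · exact hJ _ hl
    obtain ⟨k, hk⟩ := h1
    have h2 := blockStart_le (J := J) p
    conv_rhs => rw [← Nat.sub_add_cancel h2, hk, Nat.add_mul_mod_self_left]
    rw [hk]
  have hdet : A.det = A'.det := by
    rw [htri.det, htri'.det]
    refine Finset.prod_congr rfl fun k _ => congrArg Matrix.det ?_
    ext ⟨p, hp⟩ ⟨q, hq⟩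
    have h1 : (p : ℕ) - blockStart J p = q - blockStart J q :=
      congrArg (fun k => (ofLex k).1) (hp.trans hq.symm)
    have h2 : (p : ℕ) % c = (q : ℕ) % c := by rw [← hmod p, h1, hmod]
    simp [A', Matrix.toSquareBlock_def, h2]
  let S : Fin c → Matrix (Fin m) (Fin m) ℂ := fun r =>
    A.submatrix (fun i => residueEquiv h (i, r)) fun i => residueEquiv h (i, r)
  have hblock : A'.submatrix (residueEquiv h) (residueEquiv h) = Matrix.blockDiagonal S := by
    ext ⟨i, r⟩ ⟨j, s⟩
    rw [Matrix.submatrix_apply, Matrix.blockDiagonal_apply]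
    simp only [A', Matrix.of_apply, residueEquiv_val, Nat.add_mul_mod_self_left,
      Nat.mod_eq_of_lt r.2, Nat.mod_eq_of_lt s.2, ← Fin.ext_iff]
    split_ifs with hl
    · subst hl; rfl
    · rfl
  have hS : ∀ r : ℕ, ∀ hr : r < c, S ⟨r, hr⟩ = S 0 := by
    intro r
    induction r with
    | zero => intro hr; rfl
    | succ r ih =>
      intro hr
      rw [← ih (by omega)]
      ext i j
      -- Since 0 < r + 1 < c, the shifted index is not a multiple of c, so it is not a cut and the
      -- shift relation has no boundary term.
      have hcut : ∀ i : Fin m, r + c * i + 1 < N ∧ r + c * i + 1 ∉ J := fun i => by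
        refine ⟨?_, fun hl => ?_⟩
        · exact lt_of_eq_of_lt (by rw [residueEquiv_val]; simp; ring)
            (residueEquiv h (i, ⟨r + 1, hr⟩)).2
        · have := hJ _ hl
          rw [add_right_comm] at this
          have := (Nat.dvd_add_left (dvd_mul_right c (i : ℕ))).mp this
          exact absurd (Nat.le_of_dvd (by omega) this) (by omega)
      have h1 := hF (r + c * i) (by have := (hcut i).1; omega) (r + c * j + 1) (hcut j).1
      rw [if_pos (hcut i), if_pos ⟨by omega, (hcut j).2⟩, Nat.add_sub_cancel] at h1
      change F (r + c * i + 1) (r + c * j + 1) = F (r + c * i) (r + c * j) at h1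
      have h2 := hFA (residueEquiv h (i, ⟨r + 1, hr⟩)) (residueEquiv h (j, ⟨r + 1, hr⟩))
      have h3 := hFA (residueEquiv h (i, ⟨r, by omega⟩)) (residueEquiv h (j, ⟨r, by omega⟩))
      simp only [residueEquiv_val, add_right_comm r 1] at h2 h3
      simp only [S, Matrix.submatrix_apply]
      rw [← h2, ← h3, h1]
  rw [hdet, ← Matrix.det_submatrix_equiv_self (residueEquiv h), hblock, Matrix.det_blockDiagonal,
    Finset.prod_congr rfl fun r _ => congrArg Matrix.det (hS r.1 r.2), Finset.prod_const,
    Finset.card_univ, Fintype.card_fin]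
  rfl

theorem residueDet_smul [NeZero c] (h : m * c = N) (ζ : ℂ) (A : Matrix (Fin N) (Fin N) ℂ) :
    residueDet h (ζ • A) = ζ ^ m * residueDet h A := by
  rw [residueDet, Matrix.submatrix_smul, Pi.smul_apply, Pi.smul_apply, Matrix.det_smul, Fintype.card_fin]
  rfl

theorem continuous_residueDet [NeZero c] (h : m * c = N) : Continuous (residueDet h) :=
  (continuous_id.matrix_submatrix _ _).matrix_det

theorem residueDet_one [NeZero c] (h : m * c = N) : residueDet h 1 = 1 := by
  rw [residueDet, Matrix.submatrix_one _ fun i j hij => by simpa using hij, Matrix.det_one]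

end Delta

open scoped unitInterval Topology

/-! ### Bézout coefficients for J ∪ {n + 1} -/

section Gcd

theorem exists_gcd_eq_sum (s : Finset ℕ) :
    ∃ b : ℕ → ℤ, ((s.gcd id : ℕ) : ℤ) = ∑ d ∈ s, b d * d := by
  induction s using Finset.induction with
  | empty => exact ⟨0, by simp⟩
  | insert a s ha ih =>
    obtain ⟨b, hb⟩ := ih
    refine ⟨Function.update (fun d => Nat.gcdB a (s.gcd id) * b d) a (Nat.gcdA a (s.gcd id)), ?_⟩
    rw [Finset.gcd_insert, Finset.sum_insert ha, Function.update_self]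
    have h1 : ∑ d ∈ s, Function.update (fun d => Nat.gcdB a (s.gcd id) * b d) a
        (Nat.gcdA a (s.gcd id)) d * d = Nat.gcdB a (s.gcd id) * ∑ d ∈ s, b d * d := by
      rw [Finset.mul_sum]
      refine Finset.sum_congr rfl fun d hd => ?_
      rw [Function.update_of_ne (fun h : d = a => ha (h ▸ hd)), mul_assoc]
    rw [h1, ← hb]
    have := Nat.gcd_eq_gcd_ab a (s.gcd id)
    change ((Nat.gcd a (s.gcd id) : ℕ) : ℤ) = _
    rw [this]; ring

/-- The greatest common divisor of `J ∪ {n + 1}`. -/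
abbrev gcdJ (n : ℕ) (J : Finset ℕ) : ℕ := (insert (n + 1) J).gcd id

theorem gcdJ_dvd (n : ℕ) (J : Finset ℕ) : gcdJ n J ∣ n + 1 :=
  Finset.gcd_dvd (f := id) (Finset.mem_insert_self _ _)

theorem gcdJ_dvd_of_mem {n : ℕ} {J : Finset ℕ} {d : ℕ} (hd : d ∈ J) : gcdJ n J ∣ d :=
  Finset.gcd_dvd (f := id) (Finset.mem_insert_of_mem hd)

theorem gcdJ_pos (n : ℕ) (J : Finset ℕ) : 0 < gcdJ n J :=
  Nat.pos_of_dvd_of_pos (gcdJ_dvd n J) n.succ_pos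

instance (n : ℕ) (J : Finset ℕ) : NeZero (gcdJ n J) := ⟨(gcdJ_pos n J).ne'⟩

/-- The quotient of `n + 1` by the greatest common divisor of `J ∪ {n + 1}`. -/
abbrev coindex (n : ℕ) (J : Finset ℕ) : ℕ := (n + 1) / gcdJ n J

theorem coindex_mul (n : ℕ) (J : Finset ℕ) : coindex n J * gcdJ n J = n + 1 :=
  Nat.div_mul_cancel (gcdJ_dvd n J)

end Gcd

/-! ### The central elements in the identity component -/

section Centralizer

variable {n : ℕ} {J : Finset ℕ}

theorem repX_val : (repX n J).1 = cutNilpotent J (n + 1) := by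
  ext p q
  have h1 : (repX n J).1 = ∑ i : Fin n, if (i : ℕ) + 1 ∈ J then 0 else
      Matrix.single i.castSucc i.succ (1 : ℂ) := by
    rw [repX, AddSubmonoidClass.coe_finsetSum]
    refine Finset.sum_congr rfl fun i _ => ?_
    split_ifs <;> rfl
  rw [h1, Matrix.sum_apply]
  simp only [cutNilpotent, Matrix.of_apply]
  split_ifs with h
  · have hp : (p : ℕ) < n := by have := q.2; omega
    rw [Finset.sum_eq_single ⟨p, hp⟩]
    · have h2 : ¬ ((p : ℕ) + 1 ∈ J) := h.1 ▸ h.2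
      have e1 : (⟨p, hp⟩ : Fin n).castSucc = p := rfl
      have e2 : (⟨p, hp⟩ : Fin n).succ = q := Fin.ext h.1.symm
      rw [if_neg h2, e1, e2, Matrix.single_apply_same]
    · intro i _ hi
      split_ifs
      · rfl
      · refine Matrix.single_apply_of_ne _ _ _ _ _ fun hh => hi ?_
        exact Fin.castSucc_injective n hh.1
    · simp
  · refine Finset.sum_eq_zero fun i _ => ?_
    split_ifs with h2
    · rfl
    · refine Matrix.single_apply_of_ne _ _ _ _ _ fun hh => h ?_
      rw [← hh.1, ← hh.2]
      exact ⟨rfl, h2⟩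

variable {t : torus n} {x : nilradical n}

theorem torusAd_apply (t : torus n) (x : nilradical n) (p q : Fin (n + 1)) :
    (torusAd n t x).1 p q = (t.1 p : ℂ) * x.1 p q * (t.1 q : ℂ)⁻¹ := by
  change (Matrix.diagonal (fun k => (t.1 k : ℂ)) * x.1 *
      Matrix.diagonal (fun k => (t⁻¹.1 k : ℂ))) p q = _
  rw [Matrix.mul_diagonal, Matrix.diagonal_mul]
  simp

theorem torusAd_repX_support {p q : Fin (n + 1)} (h : (torusAd n t (repX n J)).1 p q ≠ 0) :
    (q : ℕ) = p + 1 ∧ (q : ℕ) ∉ J := by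
  by_contra h1
  apply h
  rw [torusAd_apply, repX_val, cutNilpotent, Matrix.of_apply, if_neg h1]
  simp

/-- Every element of the centralizer can be multiplied by a central element so as to land in the
identity component. -/
theorem exists_centre_mul_mem_component (x : nilradical n) {g : G n} (hg : g ∈ slCentralizer x) :
    ∃ z : centre n, torusToSL n z.1 * g ∈ centralizerComponent x := by
  rw [mem_slCentralizer] at hg
  -- This complex line in the commutant of x runs from g at 0 to the identity at 1. Its determinant
  -- is a nonzero polynomial in z, so a path from 0 to 1 can avoid the zeros.
  let A : ℂ → Matrix (Fin (n + 1)) (Fin (n + 1)) ℂ := fun z => g.1 + z • (1 - g.1)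
  have hAc : Continuous A := continuous_const.add (continuous_id.smul continuous_const)
  have hAx : ∀ z, A z * x.1 = x.1 * A z := fun z => by
    simp only [A, Matrix.add_mul, Matrix.mul_add, Matrix.smul_mul, Matrix.mul_smul,
      Matrix.sub_mul, Matrix.mul_sub, hg, Matrix.one_mul, Matrix.mul_one]
  have hfin : {z | (A z).det = 0}.Finite := by
    let P : Polynomial ℂ := Matrix.det (g.1.map Polynomial.C +
      (Polynomial.X : Polynomial ℂ) • (1 - g.1).map Polynomial.C)
    have hP : ∀ z, P.eval z = (A z).det := fun z => by
      rw [← Polynomial.coe_evalRingHom, RingHom.map_det]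
      congr 1
      ext i j
      simp [A]
    have hP0 : P ≠ 0 := fun h => by
      have := hP 0
      simp [h, A, g.2] at this
    refine (Polynomial.finite_setOfPred_isRoot hP0).subset fun z hz => ?_
    rw [Set.mem_ofPred_eq, Polynomial.IsRoot, hP]; exact hz
  have hconn := hfin.countable.isPathConnected_compl_of_one_lt_rank (E := ℂ)
    (by rw [Complex.rank_real_complex]; exact Cardinal.one_lt_two)
  obtain ⟨ρ, hρ⟩ := hconn.joinedIn 0 (by simp [A, g.2]) 1 (by simp [A])
  let d : C(I, {z : ℂ // z ≠ 0}) := ⟨fun s => ⟨(A (ρ s)).det, hρ s⟩,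
    ((hAc.comp ρ.continuous).matrix_det).subtype_mk _⟩
  obtain ⟨L, hL, hL0⟩ := Complex.isCoveringMap_exp.exists_path_lifts d 0
    (Subtype.ext (by simp [d, A, g.2]))
  have hLd : ∀ s, Complex.exp (L s) = (A (ρ s)).det := fun s =>
    congrArg Subtype.val (congrFun hL s)
  have hn : ((n + 1 : ℕ) : ℂ) ≠ 0 := by exact_mod_cast n.succ_ne_zero
  -- A continuous (n+1)-th root of 1/det along the path, starting at 1. It may end at a nontrivial
  -- root of unity, which is the source of the central factor.
  let e : I → ℂ := fun s => Complex.exp (-(L s / ((n + 1 : ℕ) : ℂ)))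
  have hec : Continuous e := by fun_prop
  have he : ∀ s, e s ^ (n + 1) = ((A (ρ s)).det)⁻¹ := fun s => by
    rw [← Complex.exp_nat_mul, mul_neg, mul_div_cancel₀ _ hn, Complex.exp_neg, hLd]
  have hdet : ∀ s, (e s • A (ρ s)).det = 1 := fun s => by
    rw [Matrix.det_smul, Fintype.card_fin, he, inv_mul_cancel₀ (hρ s)]
  have he1 : e 1 ^ (n + 1) = 1 := by rw [he]; simp [A]
  have he10 : e 1 ≠ 0 := Complex.exp_ne_zero _
  obtain ⟨z, hz⟩ := exists_scalarOf_eq ((Units.mk0 (e 1) he10)⁻¹) (by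
    rw [inv_pow, inv_eq_one]; exact Units.ext (by simpa using he1))
  have hzv : (scalarOf z : ℂ) = (e 1)⁻¹ := by rw [hz]; simp
  refine ⟨z, ?_⟩
  rw [mem_centralizerComponent]
  let B : I → G n := fun s => ⟨e s • A (ρ s), hdet s⟩
  have hB : Continuous B := (hec.smul (hAc.comp ρ.continuous)).subtype_mk _
  have hB0 : B 0 = g := Subtype.ext (by simp [B, e, A, hL0])
  have hB1 : torusToSL n z.1 * B 1 = 1 := by
    refine Subtype.ext ?_
    rw [torusToSL_centre_mul, hzv]
    simp [B, A, he10]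
  refine JoinedIn.symm ⟨⟨⟨fun s => torusToSL n z.1 * B s, continuous_const.mul hB⟩,
    congrArg (torusToSL n z.1 * ·) hB0, hB1⟩, fun s => ?_⟩
  refine mem_slCentralizer.mpr ?_
  change (torusToSL n z.1 * B s).1 * x.1 = x.1 * (torusToSL n z.1 * B s).1
  rw [torusToSL_centre_mul]
  change ((scalarOf z : ℂ) • e s • A (ρ s)) * x.1 = x.1 * ((scalarOf z : ℂ) • e s • A (ρ s))
  simp only [Matrix.smul_mul, Matrix.mul_smul, hAx]

/-- The central elements that lie in the identity component of the centralizer. -/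
theorem centre_mem_component (hJ : J ⊆ Finset.Icc 1 n)
    (hx : ∀ p q, x.1 p q ≠ 0 → (q : ℕ) = p + 1 ∧ (q : ℕ) ∉ J) {z : centre n}
    (hz : scalarOf z ^ coindex n J = 1) : torusToSL n z.1 ∈ centralizerComponent x := by
  obtain ⟨b, hb⟩ := exists_gcd_eq_sum (insert (n + 1) J)
  set S := insert (n + 1) J with hS
  have hSn : ∀ d ∈ S, d ≤ n + 1 := fun d hd => by
    rcases Finset.mem_insert.mp hd with h | h
    · exact h.le
    · have := (Finset.mem_Icc.mp (hJ h)).2; omega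
  -- An integer function constant on blocks, with total Σ b_d d = c.
  let f : ℕ → ℤ := fun p => ∑ d ∈ S, if p < d then b d else 0
  have hfsum : ∑ p : Fin (n + 1), f p = gcdJ n J := by
    change _ = ((S.gcd id : ℕ) : ℤ)
    rw [hb, Fin.sum_univ_eq_sum_range (fun p => f p), Finset.sum_comm]
    refine Finset.sum_congr rfl fun d hd => ?_
    rw [← Finset.sum_filter, Finset.sum_const, nsmul_eq_mul, mul_comm]
    congr 2
    have : (Finset.range (n + 1)).filter (· < d) = Finset.range d := by
      ext p; have := hSn d hd; simp; omega
    rw [this, Finset.card_range]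
  have hfsucc : ∀ p : ℕ, p + 1 < n + 1 → p + 1 ∉ J → f (p + 1) = f p := fun p hp hpJ => by
    refine Finset.sum_congr rfl fun d hd => ?_
    have : d ≠ p + 1 := by
      rintro rfl
      rcases Finset.mem_insert.mp hd with h | h
      · omega
      · exact hpJ h
    have h2 : p + 1 < d ↔ p < d := by omega
    simp only [h2]
  have hpi : (2 * Real.pi * Complex.I : ℂ) ≠ 0 := Complex.two_pi_I_ne_zero
  let θ : ℂ := Complex.log (scalarOf z) / (2 * Real.pi * Complex.I)
  have hθ : Complex.exp (2 * Real.pi * Complex.I * θ) = scalarOf z := by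
    rw [mul_div_cancel₀ _ hpi, Complex.exp_log (scalarOf z).ne_zero]
  obtain ⟨k, hk⟩ : ∃ k : ℤ, (coindex n J : ℂ) * θ = k := by
    have h1 : Complex.exp ((coindex n J : ℂ) * (2 * Real.pi * Complex.I * θ)) = 1 := by
      rw [Complex.exp_nat_mul, hθ, ← Units.val_pow_eq_pow_val, hz, Units.val_one]
    obtain ⟨k, hk⟩ := Complex.exp_eq_one_iff.mp h1
    refine ⟨k, mul_right_cancel₀ hpi ?_⟩
    rw [← hk]; ring
  -- Each v(p) is congruent to θ mod ℤ, so the path ends at the scalar ζ. The total is (n+1)θ - kc =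
  -- c(mθ - k) = 0, which keeps the determinant 1. Constancy on blocks keeps the path in the
  -- centralizer.
  let v : ℕ → ℂ := fun p => θ - k * f p
  have hvsum : ∑ p : Fin (n + 1), v p = 0 := by
    have h1 : ∑ p : Fin (n + 1), v p = ((n + 1 : ℕ) : ℂ) * θ - k * ((∑ p : Fin (n + 1), f p : ℤ) : ℂ) := by
      simp only [v, Finset.sum_sub_distrib, Finset.sum_const, Finset.card_univ, Fintype.card_fin,
        nsmul_eq_mul, Int.cast_sum, Finset.mul_sum]
    rw [h1, hfsum, ← coindex_mul n J, ← hk]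
    push_cast
    ring
  let D : ℝ → Fin (n + 1) → ℂ := fun s p => Complex.exp (2 * Real.pi * Complex.I * (s * v p))
  have hDdet : ∀ s, (Matrix.diagonal (D s)).det = 1 := fun s => by
    rw [Matrix.det_diagonal, ← Complex.exp_sum, ← Finset.mul_sum, ← Finset.mul_sum, hvsum]
    simp
  have hDc : Continuous fun s : I => Matrix.diagonal (D s) := by
    refine Continuous.matrix_diagonal (continuous_pi fun p => ?_)
    simp only [D]
    fun_prop
  rw [mem_centralizerComponent]
  refine ⟨⟨⟨fun s => ⟨Matrix.diagonal (D s), hDdet s⟩, hDc.subtype_mk _⟩, ?_, ?_⟩, fun s => ?_⟩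
  · refine Subtype.ext ?_
    simp [D]
  · refine Subtype.ext ?_
    rw [torusToSL_centre]
    change Matrix.diagonal (D (1 : ℝ)) = _
    rw [← Matrix.diagonal_one, ← Matrix.diagonal_smul]
    congr 1
    ext p
    have h1 : Complex.exp (2 * Real.pi * Complex.I * (k * f p)) = 1 :=
      Complex.exp_eq_one_iff.mpr ⟨k * f p, by push_cast; ring⟩
    simp only [D, v, Complex.ofReal_one, one_mul, mul_sub, Complex.exp_sub, hθ, h1]
    simp
  · refine mem_slCentralizer.mpr ?_
    change Matrix.diagonal (D s) * x.1 = x.1 * Matrix.diagonal (D s)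
    ext p q
    rw [Matrix.diagonal_mul, Matrix.mul_diagonal]
    by_cases h : x.1 p q = 0
    · rw [h]; ring
    · obtain ⟨h1, h2⟩ := hx p q h
      have h3 : D s p = D s q := by
        have : f q = f p := by
          rw [h1]; exact hfsucc p (h1 ▸ q.2) (h1 ▸ h2)
        simp only [D, v, this]
      rw [h3, mul_comm]

/-- The fundamental group of the orbit of a point of the `T`-orbit of `X_J`. -/
theorem nonempty_mulEquiv_orbitPi1_torusAd (hJ : J ⊆ Finset.Icc 1 n) (t : torus n)
    (D₀ : Subgroup (centre n)) (hD₀ : ∀ z, z ∈ D₀ ↔ scalarOf z ^ coindex n J = 1) :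
    Nonempty (centre n ⧸ D₀ ≃* orbitPi1 n (torusAd n t (repX n J))) := by
  set x := torusAd n t (repX n J) with hxdef
  let τ := torusToSL n t
  have hN := coindex_mul n J
  -- x is conjugate to X_J by τ, so the minor is taken after conjugating back.
  let δ : Matrix (Fin (n + 1)) (Fin (n + 1)) ℂ → ℂ := fun A =>
    residueDet hN ((τ⁻¹).1 * A * τ.1)
  have hδ : Continuous δ := (continuous_residueDet hN).comp
    ((continuous_const.matrix_mul continuous_id).matrix_mul continuous_const)
  have hδpow : ∀ g ∈ slCentralizer x, δ g.1 ^ gcdJ n J = 1 := by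
    intro g hg
    rw [mem_slCentralizer] at hg
    have hxτ : x.1 = τ.1 * cutNilpotent J (n + 1) * (τ⁻¹).1 := by
      rw [← repX_val]
      change (torusToSL n t).1 * (repX n J).1 * (torusToSL n t⁻¹).1 = _
      rw [map_inv]
    rw [residueDet_pow hN (fun d hd => gcdJ_dvd_of_mem hd), Matrix.det_mul, Matrix.det_mul, τ.2,
      (τ⁻¹).2, g.2]
    · simp
    · have h1 : (τ⁻¹).1 * (g.1 * x.1) * τ.1 = (τ⁻¹).1 * (x.1 * g.1) * τ.1 := by rw [hg]
      rw [hxτ] at h1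
      have h2 : (τ⁻¹).1 * (τ.1 * cutNilpotent J (n + 1) * (τ⁻¹).1 * g.1) * τ.1 =
          cutNilpotent J (n + 1) * ((τ⁻¹).1 * g.1 * τ.1) := by
        simp only [← Matrix.mul_assoc, SL_inv_mul, Matrix.one_mul]
      have h3 : (τ⁻¹).1 * (g.1 * (τ.1 * cutNilpotent J (n + 1) * (τ⁻¹).1)) * τ.1 =
          (τ⁻¹).1 * g.1 * τ.1 * cutNilpotent J (n + 1) := by
        simp only [Matrix.mul_assoc, SL_inv_mul, Matrix.mul_one]
      rw [← h3, ← h2, h1]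
  have hδ1 : δ 1 = 1 := by
    simp only [δ, Matrix.mul_one, SL_inv_mul, residueDet_one]
  refine nonempty_mulEquiv_orbitPi1 x hδ (fun g hg => ?_) (fun ζ A => ?_)
    (fun g hg => exists_centre_mul_mem_component x hg)
    (fun z hz => centre_mem_component hJ (fun p q h => torusAd_repX_support h) hz) D₀ hD₀
  · obtain ⟨γ, hγ⟩ := mem_centralizerComponent.mp hg
    let S : Set ℂ := ((Polynomial.nthRoots (gcdJ n J) (1 : ℂ)).toFinset : Set ℂ)
    have hSd : IsDiscrete S := (Finset.finite_toSet _).isDiscrete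
    have hc : Continuous fun s => δ (γ s).1 :=
      hδ.comp (continuous_subtype_val.comp γ.continuous)
    -- Along a path in the centralizer δ takes values in the finite set of c-th roots of unity,
    -- hence is constant.
    have := isPreconnected_univ.constant_of_mapsTo hSd hc.continuousOn (fun s _ => by
      simp only [S, Finset.mem_coe, Multiset.mem_toFinset]
      rw [Polynomial.mem_nthRoots (gcdJ_pos n J)]
      exact hδpow _ (hγ s)) (Set.mem_univ (1 : I)) (Set.mem_univ (0 : I))
    simp only [Path.target, Path.source] at this
    rw [this]
    exact hδ1
  · simp only [δ, Matrix.mul_smul, Matrix.smul_mul, residueDet_smul]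

end Centralizer

/-! ### Monomials and summation by parts -/

section CommGroup

variable {A : Type*} [CommGroup A] {n : ℕ}

theorem prod_zpow_eq_zpow_sum {ι : Type*} (s : Finset ι) (e : ι → ℤ) (g : A) :
    ∏ i ∈ s, g ^ e i = g ^ ∑ i ∈ s, e i := by
  classical
  induction s using Finset.induction_on with
  | empty => simp
  | insert i s hi ih => rw [Finset.prod_insert hi, Finset.sum_insert hi, ih, zpow_add]

/-- The sum of the first `d` coordinates. -/
def partialSum (a : Fin (n + 1) → ℤ) (d : ℕ) : ℤ := ∑ p : Fin (n + 1), if (p : ℕ) < d then a p else 0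

theorem partialSum_zero (a : Fin (n + 1) → ℤ) : partialSum a 0 = 0 := by simp [partialSum]

theorem partialSum_succ (a : Fin (n + 1) → ℤ) (p : Fin (n + 1)) :
    partialSum a (p + 1) = partialSum a p + a p := by
  have h : a p = ∑ q : Fin (n + 1), if q = p then a q else 0 := by simp
  rw [partialSum, partialSum, h, ← Finset.sum_add_distrib]
  refine Finset.sum_congr rfl fun q _ => ?_
  rcases lt_trichotomy q p with h1 | h1 | h1
  · have h2 : (q : ℕ) < p := h1
    rw [if_pos (by omega), if_pos h2, if_neg h1.ne, add_zero]
  · subst h1; simp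
  · have h2 : (p : ℕ) < q := h1
    rw [if_neg (by omega), if_neg (by omega), if_neg h1.ne', add_zero]

theorem partialSum_top (a : Fin (n + 1) → ℤ) : partialSum a (n + 1) = ∑ p, a p :=
  Finset.sum_congr rfl fun p _ => if_pos p.2

/-- The monomial in the `f p` with exponents `a p`. -/
def monomialProd (f : Fin (n + 1) → A) (a : Fin (n + 1) → ℤ) : A := ∏ p, f p ^ a p

theorem monomialProd_add (f : Fin (n + 1) → A) (a b : Fin (n + 1) → ℤ) :
    monomialProd f (a + b) = monomialProd f a * monomialProd f b := by
  simp only [monomialProd, Pi.add_apply, zpow_add, Finset.prod_mul_distrib]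

theorem monomialProd_zsmul (f : Fin (n + 1) → A) (k : ℤ) (a : Fin (n + 1) → ℤ) :
    monomialProd f (k • a) = monomialProd f a ^ k := by
  simp only [monomialProd, Pi.smul_apply, smul_eq_mul, mul_comm k, zpow_mul, Finset.prod_zpow]

theorem monomialProd_zero (f : Fin (n + 1) → A) : monomialProd f 0 = 1 := by
  simp [monomialProd]

theorem monomialProd_neg (f : Fin (n + 1) → A) (a : Fin (n + 1) → ℤ) :
    monomialProd f ((-1 : ℤ) • a) = (monomialProd f a)⁻¹ := by
  rw [monomialProd_zsmul, zpow_neg_one]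

theorem monomialProd_single (f : Fin (n + 1) → A) (p : Fin (n + 1)) :
    monomialProd f (Pi.single p 1) = f p := by
  rw [monomialProd, Finset.prod_eq_single p]
  · simp
  · intro q _ hq; simp [hq]
  · simp

/-- Summation by parts: a monomial with exponents of sum zero is a product of powers of the
successive quotients. -/
theorem monomialProd_eq_prod_div (f : Fin (n + 1) → A) (a : Fin (n + 1) → ℤ)
    (ha : partialSum a (n + 1) = 0) :
    monomialProd f a = ∏ i : Fin n, (f i.castSucc / f i.succ) ^ partialSum a (i + 1) := by
  have h1 : monomialProd f a = (∏ p : Fin (n + 1), f p ^ partialSum a (p + 1)) /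
      ∏ p : Fin (n + 1), f p ^ partialSum a p := by
    rw [monomialProd, ← Finset.prod_div_distrib]
    refine Finset.prod_congr rfl fun p _ => ?_
    rw [partialSum_succ, zpow_add, mul_div_cancel_left]
  rw [h1, Fin.prod_univ_castSucc, Fin.prod_univ_succ (fun p => f p ^ partialSum a p)]
  simp only [Fin.val_last, ha, Fin.val_zero, partialSum_zero, zpow_zero, mul_one, one_mul,
    Fin.val_castSucc, Fin.val_succ]
  rw [← Finset.prod_div_distrib]
  refine Finset.prod_congr rfl fun i _ => ?_
  rw [div_zpow]

/-- A monomial with exponents of sum zero and nonnegative partial sums is a product of natural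
powers of the successive quotients. -/
theorem monomialProd_eq_prod_div_pow (f : Fin (n + 1) → A) (a : Fin (n + 1) → ℤ)
    (ha : partialSum a (n + 1) = 0) (ha' : ∀ i : Fin n, 0 ≤ partialSum a (i + 1)) :
    monomialProd f a = ∏ i : Fin n, (f i.castSucc / f i.succ) ^ (partialSum a (i + 1)).toNat := by
  rw [monomialProd_eq_prod_div f a ha]
  refine Finset.prod_congr rfl fun i _ => ?_
  rw [← zpow_natCast, Int.toNat_of_nonneg (ha' i)]

theorem monomialProd_add_const (f : Fin (n + 1) → A) (hf : monomialProd f (fun _ => -1) = 1) (k : ℕ)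
    (a : Fin (n + 1) → ℤ) :
    monomialProd f (((k : ℤ) • a) + fun _ => -1) = monomialProd f a ^ k := by
  rw [monomialProd_add, hf, mul_one, monomialProd_zsmul, zpow_natCast]

theorem monomialProd_eq_zpow_mul (f : Fin (n + 1) → A) (k : ℤ) (a b : Fin (n + 1) → ℤ) :
    monomialProd f a = monomialProd f b ^ k * monomialProd f (a + (-k) • b) := by
  rw [monomialProd_add, monomialProd_zsmul, zpow_neg, mul_comm, mul_assoc, inv_mul_cancel, mul_one]

theorem monomialProd_single_add_neg (f : Fin (n + 1) → A) (p q : Fin (n + 1)) :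
    monomialProd f (Pi.single p 1 + (-1 : ℤ) • Pi.single q 1) = f p / f q := by
  rw [monomialProd_add, monomialProd_neg, monomialProd_single, monomialProd_single, div_eq_mul_inv]

theorem monomialProd_mem (f : Fin (n + 1) → A) (a : Fin (n + 1) → ℤ) (S : Subgroup A)
    (h : ∀ p, f p ∈ S) : monomialProd f a ∈ S :=
  Subgroup.prod_mem _ fun p _ => Subgroup.zpow_mem _ (h p) _

theorem monomialProd_mem_of_div (f : Fin (n + 1) → A) (a : Fin (n + 1) → ℤ)
    (ha : partialSum a (n + 1) = 0) (S : Subgroup A)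
    (h : ∀ i : Fin n, partialSum a (i + 1) ≠ 0 → f i.castSucc / f i.succ ∈ S) :
    monomialProd f a ∈ S := by
  rw [monomialProd_eq_prod_div f a ha]
  refine Subgroup.prod_mem _ fun i _ => ?_
  by_cases hi : partialSum a (i + 1) = 0
  · rw [hi, zpow_zero]; exact one_mem _
  · exact Subgroup.zpow_mem _ (h i hi) _

theorem zpow_mul_mem {S : Subgroup A} {g h : A} (k : ℤ) (hg : g ∈ S) (hh : h ∈ S) :
    g ^ k * h ∈ S :=
  mul_mem (zpow_mem hg k) hh

end CommGroup

/-! ### Weights, fundamental coweights and the character η -/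

section Characters

variable {n : ℕ} {J : Finset ℕ}

theorem simpleRoot_apply (i : Fin n) (t : torus n) :
    simpleRoot n i t = t.1 i.castSucc / t.1 i.succ := rfl

/-- The character with the given exponents. -/
def charOf (a : Fin (n + 1) → ℤ) : torus n →* ℂˣ := monomialProd (coordChar n) a

theorem charOf_add (a b : Fin (n + 1) → ℤ) : charOf (a + b) = charOf a * charOf b :=
  monomialProd_add _ a b

theorem charOf_apply (a : Fin (n + 1) → ℤ) (t : torus n) : charOf a t = ∏ p, t.1 p ^ a p := by
  rw [charOf, monomialProd, MonoidHom.finsetProd_apply]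
  rfl

theorem charOf_mem (a : Fin (n + 1) → ℤ) : charOf a ∈ weightLattice n :=
  monomialProd_mem _ a _ fun p => Subgroup.subset_closure (Set.mem_range_self p)

theorem exists_charOf_eq {χ : torus n →* ℂˣ} (hχ : χ ∈ weightLattice n) : ∃ a, charOf a = χ := by
  induction hχ using Subgroup.closure_induction with
  | mem χ h =>
    obtain ⟨p, rfl⟩ := h
    exact ⟨Pi.single p 1, monomialProd_single _ p⟩
  | one => exact ⟨0, monomialProd_zero _⟩
  | mul χ ψ _ _ h1 h2 =>
    obtain ⟨a, rfl⟩ := h1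
    obtain ⟨b, rfl⟩ := h2
    exact ⟨a + b, charOf_add a b⟩
  | inv χ _ h =>
    obtain ⟨a, rfl⟩ := h
    exact ⟨(-1 : ℤ) • a, monomialProd_neg _ a⟩

/-- The characters with constant exponents are trivial on the torus. -/
theorem charOf_const (k : ℤ) : charOf (fun _ : Fin (n + 1) => k) = 1 := by
  ext t
  have h : ∏ i, t.1 i = 1 := t.2
  rw [charOf_apply, Finset.prod_zpow, h, one_zpow]; rfl

theorem simpleRoot_centre (i : Fin n) (z : centre n) : simpleRoot n i z.1 = 1 := by
  rw [simpleRoot_apply, centre_apply, centre_apply, div_self']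

theorem charOf_centre (a : Fin (n + 1) → ℤ) (z : centre n) :
    charOf a z.1 = scalarOf z ^ partialSum a (n + 1) := by
  rw [charOf_apply, partialSum_top]
  simp only [centre_apply]
  rw [prod_zpow_eq_zpow_sum]

/-- A point of the torus on the one-parameter subgroup of a multiple of a fundamental coweight. -/
noncomputable def coweightPoint (n d : ℕ) : torus n :=
  if h : d ≤ n + 1 then ⟨fun p => Units.mk0 (2 : ℂ) two_ne_zero ^
    (if (p : ℕ) < d then ((n + 1 : ℕ) : ℤ) - d else -d), by
      change ∏ p : Fin (n + 1), _ = 1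
      rw [prod_zpow_eq_zpow_sum]
      have : ∑ p : Fin (n + 1), (if (p : ℕ) < d then ((n + 1 : ℕ) : ℤ) - d else -d) = 0 := by
        rw [Fin.sum_univ_eq_sum_range (fun p => if p < d then ((n + 1 : ℕ) : ℤ) - d else -d),
          Finset.sum_ite, Finset.sum_const, Finset.sum_const]
        have e1 : (Finset.range (n + 1)).filter (· < d) = Finset.range d := by
          ext p; simp; omega
        have e2 : (Finset.range (n + 1)).filter (fun p => ¬ p < d) = Finset.Ico d (n + 1) := by
          ext p; simp; omega
        rw [e1, e2, Finset.card_range, Nat.card_Ico, nsmul_eq_mul, nsmul_eq_mul, Nat.cast_sub h]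
        ring
      rw [this, zpow_zero]⟩ else 1

/-- The size of a character on a fundamental coweight. -/
noncomputable def coweightNorm (d : ℕ) (χ : torus n →* ℂˣ) : ℝ := ‖(χ (coweightPoint n d) : ℂ)‖

theorem coweightNorm_mul (d : ℕ) (χ ψ : torus n →* ℂˣ) :
    coweightNorm d (χ * ψ) = coweightNorm d χ * coweightNorm d ψ := by
  simp [coweightNorm]

theorem coweightNorm_one (d : ℕ) : coweightNorm d (1 : torus n →* ℂˣ) = 1 := by
  simp [coweightNorm]

theorem coweightNorm_pow (d : ℕ) (χ : torus n →* ℂˣ) (k : ℕ) :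
    coweightNorm d (χ ^ k) = coweightNorm d χ ^ k := by
  simp [coweightNorm]

/-- The exponent is n + 1 times the pairing with the d-th fundamental coweight, so norm 1 means
orthogonality and norm at least 1 means nonnegative pairing. -/
theorem coweightNorm_charOf {d : ℕ} (hd : d ≤ n + 1) (a : Fin (n + 1) → ℤ) :
    coweightNorm d (charOf a) =
      2 ^ (((n + 1 : ℕ) : ℤ) * partialSum a d - d * partialSum a (n + 1)) := by
  rw [coweightNorm, charOf_apply, coweightPoint, dif_pos hd]
  simp only [← zpow_mul]
  rw [prod_zpow_eq_zpow_sum]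
  simp only [Units.val_zpow_eq_zpow_val, Units.val_mk0, norm_zpow, Complex.norm_ofNat]
  congr 1
  rw [partialSum_top, partialSum, Finset.mul_sum, Finset.mul_sum, ← Finset.sum_sub_distrib]
  refine Finset.sum_congr rfl fun p _ => ?_
  split_ifs <;> ring

theorem coweightNorm_charOf_eq_one {d : ℕ} (hd : d ≤ n + 1) (a : Fin (n + 1) → ℤ) :
    coweightNorm d (charOf a) = 1 ↔
      ((n + 1 : ℕ) : ℤ) * partialSum a d = d * partialSum a (n + 1) := by
  rw [coweightNorm_charOf hd, zpow_eq_one_iff_right₀ (by norm_num) (by norm_num), sub_eq_zero]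

theorem simpleRoot_eq_charOf (i : Fin n) :
    simpleRoot n i = charOf (Pi.single i.castSucc 1 + (-1 : ℤ) • Pi.single i.succ 1) :=
  (monomialProd_single_add_neg (coordChar n) i.castSucc i.succ).symm

theorem partialSum_simpleRoot (i : Fin n) (d : ℕ) :
    partialSum (Pi.single i.castSucc 1 + (-1 : ℤ) • Pi.single i.succ 1 : Fin (n + 1) → ℤ) d =
      if d = i + 1 then 1 else 0 := by
  have h : ∀ p : Fin (n + 1), (∑ q : Fin (n + 1), if (q : ℕ) < d then
      (Pi.single p 1 : Fin (n + 1) → ℤ) q else 0) = if (p : ℕ) < d then 1 else 0 := fun p => by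
    rw [Finset.sum_eq_single p]
    · simp
    · intro q _ hq; simp [hq]
    · simp
  have h2 : partialSum (Pi.single i.castSucc 1 + (-1 : ℤ) • Pi.single i.succ 1 :
      Fin (n + 1) → ℤ) d = (∑ q : Fin (n + 1), if (q : ℕ) < d then
      (Pi.single i.castSucc 1 : Fin (n + 1) → ℤ) q else 0) - ∑ q : Fin (n + 1), if (q : ℕ) < d then
      (Pi.single i.succ 1 : Fin (n + 1) → ℤ) q else 0 := by
    rw [partialSum, ← Finset.sum_sub_distrib]
    refine Finset.sum_congr rfl fun q _ => ?_
    split_ifs <;> simp [sub_eq_add_neg]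
  rw [h2, h, h, Fin.val_castSucc, Fin.val_succ]
  split_ifs <;> omega

theorem coweightNorm_simpleRoot {d : ℕ} (hd : d ≤ n) (i : Fin n) :
    coweightNorm d (simpleRoot n i) = if d = i + 1 then 2 ^ (n + 1) else 1 := by
  rw [simpleRoot_eq_charOf, coweightNorm_charOf (by omega), partialSum_simpleRoot,
    partialSum_simpleRoot, if_neg (by omega : ¬ n + 1 = (i : ℕ) + 1)]
  split_ifs
  · rw [mul_one, mul_zero, sub_zero, zpow_natCast]
  · simp

/-- The exponents of the character `η`, the product of the coordinates at the multiples of `c`. -/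
def etaExp (n c : ℕ) : Fin (n + 1) → ℤ := fun p => if c ∣ (p : ℕ) then 1 else 0

/-- The number of multiples of c in [0, d) is ⌈d/c⌉. -/
theorem partialSum_etaExp {c : ℕ} (hc : 0 < c) {d : ℕ} (hd : d ≤ n + 1) :
    partialSum (etaExp n c) d = ((d + c - 1) / c : ℕ) := by
  induction d with
  | zero =>
    rw [partialSum_zero, zero_add, Nat.div_eq_of_lt (by omega)]; rfl
  | succ d ih =>
    have h1 := partialSum_succ (etaExp n c) ⟨d, by omega⟩
    simp only at h1
    rw [h1, ih (by omega)]
    have h2 : d + 1 + c - 1 = (d + c - 1) + 1 := by omega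
    have h3 : d + c - 1 + 1 = d + c := by omega
    have h4 : c ∣ d + c ↔ c ∣ d := Nat.dvd_add_self_right
    rw [h2, Nat.succ_div, h3]
    simp only [etaExp, h4]
    split_ifs <;> simp

theorem le_mul_partialSum_etaExp {c : ℕ} (hc : 0 < c) {d : ℕ} (hd : d ≤ n + 1) :
    (d : ℤ) ≤ c * partialSum (etaExp n c) d := by
  rw [partialSum_etaExp hc hd]
  have := Nat.lt_mul_div_succ (d + c - 1) hc
  have h2 : c * ((d + c - 1) / c + 1) = c * ((d + c - 1) / c) + c := by ring
  have h3 : d ≤ c * ((d + c - 1) / c) := by omega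
  exact_mod_cast h3

theorem mul_partialSum_etaExp {c : ℕ} (hc : 0 < c) {d : ℕ} (hd : d ≤ n + 1) (hcd : c ∣ d) :
    (c : ℤ) * partialSum (etaExp n c) d = d := by
  rw [partialSum_etaExp hc hd]
  obtain ⟨k, rfl⟩ := hcd
  have : (c * k + c - 1) / c = k := by
    rw [Nat.add_sub_assoc hc, Nat.mul_add_div hc, Nat.div_eq_of_lt (by omega), add_zero]
  rw [this]; push_cast; rfl

/-- The character `η` generating, together with the simple roots outside `J`, the lattice of
the face of the cone. -/
def eta (n : ℕ) (J : Finset ℕ) : torus n →* ℂˣ := charOf (etaExp n (gcdJ n J))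

/-- Lowering every exponent by 1 does not change a character of T. After this the exponents of η^c
sum to 0, and their partial sums c⌈d/c⌉ - d ≥ 0 are the coefficients of the simple roots; `toNat`
loses nothing. -/
theorem eta_pow (n : ℕ) (J : Finset ℕ) : eta n J ^ gcdJ n J =
    ∏ i : Fin n, simpleRoot n i ^
      ((gcdJ n J : ℤ) * partialSum (etaExp n (gcdJ n J)) (i + 1) - ((i + 1 : ℕ) : ℤ)).toNat := by
  have hp : ∀ d, partialSum ((gcdJ n J : ℤ) • etaExp n (gcdJ n J) + fun _ => -1) d =
      gcdJ n J * partialSum (etaExp n (gcdJ n J)) d - partialSum (fun _ : Fin (n + 1) => 1) d := by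
    intro d
    simp only [partialSum, Finset.mul_sum, ← Finset.sum_sub_distrib]
    refine Finset.sum_congr rfl fun p _ => ?_
    split_ifs
    · simp only [Pi.add_apply, Pi.smul_apply, smul_eq_mul]; ring
    · ring
  have h1 : ∀ d ≤ n + 1, partialSum (fun _ : Fin (n + 1) => 1) d = d := by
    intro d hd
    induction d with
    | zero => exact partialSum_zero _
    | succ d ih =>
      have := partialSum_succ (fun _ : Fin (n + 1) => 1) ⟨d, by omega⟩
      simp only at this
      rw [this, ih (by omega)]; push_cast; ring
  have hq : ∀ d ≤ n + 1,
      partialSum ((gcdJ n J : ℤ) • etaExp n (gcdJ n J) + fun _ => -1) d =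
      gcdJ n J * partialSum (etaExp n (gcdJ n J)) d - d := fun d hd => by rw [hp, h1 d hd]
  have e : eta n J ^ gcdJ n J = charOf ((gcdJ n J : ℤ) • etaExp n (gcdJ n J) + fun _ => -1) :=
    (monomialProd_add_const _ (charOf_const _) _ _).symm
  have e2 := monomialProd_eq_prod_div_pow (coordChar n)
    ((gcdJ n J : ℤ) • etaExp n (gcdJ n J) + fun _ => -1)
    (by rw [hq _ le_rfl, mul_partialSum_etaExp (gcdJ_pos n J) le_rfl (gcdJ_dvd n J), sub_self])
    (fun i => by
      rw [hq _ (by omega)]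
      exact sub_nonneg.mpr (le_mul_partialSum_etaExp (gcdJ_pos n J) (by omega)))
  rw [e]
  refine e2.trans (Finset.prod_congr rfl fun i _ => ?_)
  rw [hq _ (by omega)]
  rfl

theorem eta_mem (n : ℕ) (J : Finset ℕ) : eta n J ∈ coneMonoid n (weightLattice n) :=
  ⟨charOf_mem _, gcdJ n J, gcdJ_pos n J, by
    rw [eta_pow]
    exact Submonoid.prod_mem _ fun i _ =>
      Submonoid.pow_mem _ (Submonoid.subset_closure (Set.mem_range_self i)) _⟩

theorem partialSum_etaExp_top (n : ℕ) (J : Finset ℕ) :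
    partialSum (etaExp n (gcdJ n J)) (n + 1) = coindex n J := by
  have h1 := mul_partialSum_etaExp (n := n) (gcdJ_pos n J) le_rfl (gcdJ_dvd n J)
  have h2 := coindex_mul n J
  have h3 : (gcdJ n J : ℤ) ≠ 0 := by exact_mod_cast (gcdJ_pos n J).ne'
  refine mul_left_cancel₀ h3 ?_
  rw [h1, ← h2]; push_cast; ring

theorem eta_centre (J : Finset ℕ) (z : centre n) : eta n J z.1 = scalarOf z ^ coindex n J := by
  rw [eta, charOf_centre, partialSum_etaExp_top, zpow_natCast]

/-- Generators of the lattice of the face of the cone that belongs to `J`. -/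
def faceGens (n : ℕ) (J : Finset ℕ) : Set (torus n →* ℂˣ) :=
  insert (eta n J) {χ | ∃ i : Fin n, (i : ℕ) + 1 ∉ J ∧ χ = simpleRoot n i}

/-- A weight that is trivial on the fundamental coweights of `J` lies in the lattice generated by
`η` and the simple roots outside `J`. -/
theorem mem_closure_faceGens (hJ : J ⊆ Finset.Icc 1 n) {χ : torus n →* ℂˣ}
    (hχ : χ ∈ weightLattice n) (h : ∀ d ∈ J, coweightNorm d χ = 1) :
    χ ∈ Subgroup.closure (faceGens n J) := by
  obtain ⟨a, rfl⟩ := exists_charOf_eq hχ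
  set c := gcdJ n J with hc
  set m := coindex n J with hm
  have hmc : ((m : ℤ) * c) = ((n + 1 : ℕ) : ℤ) := by exact_mod_cast coindex_mul n J
  have hc0 : (c : ℤ) ≠ 0 := by exact_mod_cast (gcdJ_pos n J).ne'
  have hm0 : (m : ℤ) ≠ 0 := by
    rintro h0; rw [h0, zero_mul] at hmc; exact absurd hmc.symm (by exact_mod_cast n.succ_ne_zero)
  have hle : ∀ d ∈ insert (n + 1) J, d ≤ n + 1 := fun d hd => by
    rcases Finset.mem_insert.mp hd with hd | hd
    · exact hd.le
    · have := (Finset.mem_Icc.mp (hJ hd)).2; omega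
  have hrel : ∀ d ∈ insert (n + 1) J,
      ((n + 1 : ℕ) : ℤ) * partialSum a d = d * partialSum a (n + 1) := fun d hd => by
    rcases Finset.mem_insert.mp hd with rfl | hd'
    · rfl
    · exact (coweightNorm_charOf_eq_one (hle d hd) a).mp (h d hd')
  -- With s the total exponent and P(d) the partial sums, Bézout gives cs = Σ b_d d s = (n+1) Σ b_d
  -- P(d), and n + 1 = mc.
  obtain ⟨k, hk⟩ : ∃ k, partialSum a (n + 1) = m * k := by
    obtain ⟨b, hb⟩ := exists_gcd_eq_sum (insert (n + 1) J)
    refine ⟨∑ d ∈ insert (n + 1) J, b d * partialSum a d, mul_left_cancel₀ hc0 ?_⟩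
    rw [← mul_assoc, mul_comm (c : ℤ) m, hmc, Finset.mul_sum]
    change ((gcdJ n J : ℕ) : ℤ) * _ = _
    rw [hb, Finset.sum_mul]
    refine Finset.sum_congr rfl fun d hd => ?_
    rw [mul_left_comm, hrel d hd, mul_assoc]
  have hp : ∀ d, partialSum (a + (-k) • etaExp n c) d =
      partialSum a d - k * partialSum (etaExp n c) d := by
    intro d
    simp only [partialSum, Finset.mul_sum, ← Finset.sum_sub_distrib]
    refine Finset.sum_congr rfl fun p _ => ?_
    split_ifs
    · simp only [Pi.add_apply, Pi.smul_apply, smul_eq_mul]; ring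
    · ring
  -- Dividing by η^k kills the total, hence by orthogonality every partial sum at J; summation by
  -- parts then involves only simple roots outside J.
  have hzero : ∀ d ∈ insert (n + 1) J, partialSum (a + (-k) • etaExp n c) d = 0 := by
    intro d hd
    have hcd : c ∣ d := Finset.gcd_dvd (f := id) hd
    have h1 := mul_partialSum_etaExp (gcdJ_pos n J) (hle d hd) hcd
    have h2 := hrel d hd
    rw [hk, ← hmc] at h2
    rw [hp]
    refine mul_left_cancel₀ hc0 (mul_left_cancel₀ hm0 ?_)
    linear_combination h2 - k * m * h1
  have e : charOf a = eta n J ^ k * charOf (a + (-k) • etaExp n c) :=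
    monomialProd_eq_zpow_mul _ k a (etaExp n c)
  rw [e]
  refine zpow_mul_mem k (Subgroup.subset_closure (Set.mem_insert _ _))
    (monomialProd_mem_of_div _ _ (hzero _ (Finset.mem_insert_self _ _)) _ fun i hi =>
      Subgroup.subset_closure (Or.inr ⟨i, fun hiJ => hi ?_, rfl⟩))
  exact hzero _ (Finset.mem_insert_of_mem hiJ)

end Characters

/-! ### Multiplicative functions on submonoids of abelian groups -/

section GroupLemmas

variable {A : Type*} [CommGroup A]

theorem exists_mul_eq_of_mem_closure {S : Set A} {χ : A} (hχ : χ ∈ Subgroup.closure S) :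
    ∃ p ∈ Submonoid.closure S, ∃ q ∈ Submonoid.closure S, χ * q = p := by
  induction hχ using Subgroup.closure_induction with
  | mem χ h => exact ⟨χ, Submonoid.subset_closure h, 1, one_mem _, mul_one _⟩
  | one => exact ⟨1, one_mem _, 1, one_mem _, mul_one _⟩
  | mul χ ψ _ _ h1 h2 =>
    obtain ⟨p, hp, q, hq, e⟩ := h1
    obtain ⟨p', hp', q', hq', e'⟩ := h2
    exact ⟨p * p', mul_mem hp hp', q * q', mul_mem hq hq', by rw [mul_mul_mul_comm, e, e']⟩
  | inv χ _ h =>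
    obtain ⟨p, hp, q, hq, e⟩ := h
    exact ⟨q, hq, p, hp, by rw [← e, inv_mul_cancel_left]⟩

/-- Two multiplicative functions that agree and do not vanish on a set agree on the elements of
the group that the set generates. -/
theorem eval_eq_of_mem_closure {M : Submonoid A} (f g : M →* ℂ) {S : Set A}
    (hS : ∀ s ∈ S, ∃ h : s ∈ M, f ⟨s, h⟩ = g ⟨s, h⟩ ∧ g ⟨s, h⟩ ≠ 0) {χ : A} (hχM : χ ∈ M)
    (hχ : χ ∈ Subgroup.closure S) : f ⟨χ, hχM⟩ = g ⟨χ, hχM⟩ := by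
  have key : ∀ p ∈ Submonoid.closure S, ∃ h : p ∈ M, f ⟨p, h⟩ = g ⟨p, h⟩ ∧ g ⟨p, h⟩ ≠ 0 := by
    intro p hp
    induction hp using Submonoid.closure_induction with
    | mem p hp => exact hS p hp
    | one => exact ⟨one_mem M, by
        rw [show (⟨1, one_mem M⟩ : M) = 1 from rfl, map_one, map_one]; simp⟩
    | mul p q _ _ h1 h2 =>
      obtain ⟨m1, e1, n1⟩ := h1
      obtain ⟨m2, e2, n2⟩ := h2
      refine ⟨mul_mem m1 m2, ?_⟩
      rw [show (⟨p * q, mul_mem m1 m2⟩ : M) = ⟨p, m1⟩ * ⟨q, m2⟩ from rfl, map_mul, map_mul, e1, e2]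
      exact ⟨rfl, mul_ne_zero n1 n2⟩
  obtain ⟨p, hp, q, hq, e⟩ := exists_mul_eq_of_mem_closure hχ
  obtain ⟨m1, e1, _⟩ := key p hp
  obtain ⟨m2, e2, n2⟩ := key q hq
  have e3 : (⟨χ, hχM⟩ : M) * ⟨q, m2⟩ = ⟨p, m1⟩ := Subtype.ext e
  have e4 := congrArg f e3
  have e5 := congrArg g e3
  rw [map_mul, e2] at e4
  rw [map_mul] at e5
  exact mul_right_cancel₀ n2 (e4.trans (e1.trans e5.symm))

theorem eval_pow_eq_prod {M : Submonoid A} (f : M →* ℂ) {n c : ℕ} (a : A) (g : Fin n → A)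
    (e : Fin n → ℕ) (ha : a ∈ M) (hg : ∀ i, g i ∈ M) (h : a ^ c = ∏ i, g i ^ e i) :
    f ⟨a, ha⟩ ^ c = ∏ i, f ⟨g i, hg i⟩ ^ e i := by
  have h2 : (⟨a, ha⟩ : M) ^ c = ∏ i, (⟨g i, hg i⟩ : M) ^ e i := Subtype.ext (by simpa using h)
  rw [← map_pow, h2, map_prod]
  simp only [map_pow]

end GroupLemmas

attribute [local instance 100] LieRing.ofAssociativeRing

/-! ### Superdiagonal coordinates on the abelianized nilradical -/

section Superdiagonal

variable {n : ℕ} {J : Finset ℕ}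

theorem lie_superdiagonal (x y : nilradical n) (i : Fin n) :
    (⁅x, y⁆ : nilradical n).1 i.castSucc i.succ = 0 := by
  have key : ∀ x y : nilradical n, (x.1 * y.1) i.castSucc i.succ = 0 := by
    intro x y
    rw [Matrix.mul_apply]
    refine Finset.sum_eq_zero fun k _ => ?_
    rcases le_or_gt k i.castSucc with hk | hk
    · rw [x.2 _ _ hk, zero_mul]
    · rw [y.2 k i.succ (Fin.castSucc_lt_iff_succ_le.mp hk), mul_zero]
  rw [LieSubalgebra.coe_bracket, Ring.lie_def, Matrix.sub_apply, key, key, sub_zero]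

/-- Commutators vanish on the superdiagonal, so its entries are well defined on W_ad. -/
theorem superdiagonal_eq_of_toWad_eq {x y : nilradical n} (h : toWad n x = toWad n y)
    (i : Fin n) : x.1 i.castSucc i.succ = y.1 i.castSucc i.succ := by
  have h1 : x - y ∈ (⁅(⊤ : LieIdeal ℂ (nilradical n)), (⊤ : LieIdeal ℂ (nilradical n))⁆ :
      LieIdeal ℂ (nilradical n)).toSubmodule := (Submodule.Quotient.eq _).mp h
  rw [LieSubmodule.lieIdeal_oper_eq_linear_span'] at h1
  have h2 : ∀ z ∈ Submodule.span ℂ {m : nilradical n | ∃ x ∈ (⊤ : LieIdeal ℂ (nilradical n)),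
      ∃ y ∈ (⊤ : LieIdeal ℂ (nilradical n)), ⁅x, y⁆ = m}, z.1 i.castSucc i.succ = 0 := by
    intro z hz
    induction hz using Submodule.span_induction with
    | mem z h =>
      obtain ⟨a, _, b, _, rfl⟩ := h
      exact lie_superdiagonal a b i
    | zero => rfl
    | add a b _ _ ha hb =>
      change a.1 i.castSucc i.succ + b.1 i.castSucc i.succ = 0
      rw [ha, hb, add_zero]
    | smul c a _ ha =>
      change c * a.1 i.castSucc i.succ = 0
      rw [ha, mul_zero]
  exact sub_eq_zero.mp (h2 _ h1)

theorem apply_eq_zero_of_mem_simpleRootSpan {x : nilradical n} (hx : x ∈ simpleRootSpan n)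
    {p q : Fin (n + 1)} (hpq : (q : ℕ) ≠ p + 1) : x.1 p q = 0 := by
  induction hx using Submodule.span_induction with
  | mem x h =>
    obtain ⟨i, rfl⟩ := h
    apply Matrix.single_apply_of_ne
    rintro ⟨rfl, rfl⟩
    simp at hpq
  | zero => rfl
  | add a b _ _ ha hb =>
    change a.1 p q + b.1 p q = 0
    rw [ha, hb, add_zero]
  | smul c a _ ha =>
    change c * a.1 p q = 0
    rw [ha, mul_zero]

theorem eq_of_superdiagonal_eq {x y : nilradical n}
    (hx : ∀ p q : Fin (n + 1), (q : ℕ) ≠ p + 1 → x.1 p q = 0)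
    (hy : ∀ p q : Fin (n + 1), (q : ℕ) ≠ p + 1 → y.1 p q = 0)
    (h : ∀ i : Fin n, x.1 i.castSucc i.succ = y.1 i.castSucc i.succ) : x = y := by
  refine Subtype.ext (Matrix.ext fun p q => ?_)
  by_cases hpq : (q : ℕ) = p + 1
  · have hp : (p : ℕ) < n := by omega
    have e1 : p = (⟨p, hp⟩ : Fin n).castSucc := Fin.ext rfl
    have e2 : q = (⟨p, hp⟩ : Fin n).succ := Fin.ext hpq
    have := h ⟨p, hp⟩
    rw [← e1, ← e2] at this
    exact this
  · rw [hx p q hpq, hy p q hpq]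

theorem sum_smul_simpleRootVector_mem (w : Fin n → ℂ) :
    ∑ i, w i • simpleRootVector n i ∈ simpleRootSpan n :=
  Submodule.sum_mem _ fun i _ => Submodule.smul_mem _ _ (Submodule.subset_span ⟨i, rfl⟩)

theorem sum_smul_simpleRootVector_apply (w : Fin n → ℂ) (i : Fin n) :
    (∑ j, w j • simpleRootVector n j).1 i.castSucc i.succ = w i := by
  have h : (∑ j, w j • simpleRootVector n j).1 =
      ∑ j, w j • (Matrix.single j.castSucc j.succ 1 : Matrix _ _ ℂ) := by
    rw [AddSubmonoidClass.coe_finsetSum]; rfl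
  rw [h, Matrix.sum_apply, Finset.sum_eq_single i]
  · simp
  · intro j _ hj
    have : j.castSucc ≠ i.castSucc := fun e => hj (Fin.castSucc_injective n e)
    simp [this]
  · simp

theorem repX_eq : repX n J =
    ∑ i : Fin n, (if (i : ℕ) + 1 ∈ J then (0 : ℂ) else 1) • simpleRootVector n i := by
  rw [repX]
  refine Finset.sum_congr rfl fun i _ => ?_
  split_ifs
  · rw [zero_smul]
  · rw [one_smul]

theorem torusAd_repX_apply_superdiagonal (t : torus n) (i : Fin n) :
    (torusAd n t (repX n J)).1 i.castSucc i.succ =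
      if (i : ℕ) + 1 ∈ J then 0 else (simpleRoot n i t : ℂ) := by
  rw [torusAd_apply, repX_eq, sum_smul_simpleRootVector_apply, simpleRoot_apply]
  split_ifs
  · rw [mul_zero, zero_mul]
  · rw [mul_one, div_eq_mul_inv]; push_cast; rfl

theorem torusAd_repX_apply_eq_zero (t : torus n) (p q : Fin (n + 1)) (hpq : (q : ℕ) ≠ p + 1) :
    (torusAd n t (repX n J)).1 p q = 0 := by
  rw [torusAd_apply, apply_eq_zero_of_mem_simpleRootSpan _ hpq, mul_zero, zero_mul]
  rw [repX_eq]
  exact sum_smul_simpleRootVector_mem _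

theorem eq_torusAd_of_toWad_mem_tau {x : nilradical n} (hx : x ∈ simpleRootSpan n)
    (hxJ : toWad n x ∈ tau n J) : ∃ t, x = torusAd n t (repX n J) := by
  obtain ⟨t, ht⟩ := hxJ
  exact ⟨t, eq_of_superdiagonal_eq (fun _ _ => apply_eq_zero_of_mem_simpleRootSpan hx)
    (torusAd_repX_apply_eq_zero t) fun i => superdiagonal_eq_of_toWad_eq ht.symm i⟩

end Superdiagonal

/-! ### Coordinates of the quotient map -/

section Points

variable {n : ℕ} {J : Finset ℕ}

/-- The coordinates of the image of a point of `W` in `W_ad`. -/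
noncomputable def rootValue (y : W n) (i : Fin n) : ℂ :=
  y.eval ⟨simpleRoot n i, coneMonoid_mono n (rootLattice_le n) (simpleRoot_mem_coneMonoid n i)⟩

theorem rho_eq (y : W n) : rho n y = toWad n (∑ i, rootValue y i • simpleRootVector n i) := rfl

theorem rootValue_eq_of_rho_eq {y : W n} {x : nilradical n} (h : rho n y = toWad n x) (i : Fin n) :
    rootValue y i = x.1 i.castSucc i.succ := by
  rw [rho_eq] at h
  rw [← superdiagonal_eq_of_toWad_eq h, sum_smul_simpleRootVector_apply]

theorem rho_eq_torusAd_iff (y : W n) (t : torus n) :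
    rho n y = toWad n (torusAd n t (repX n J)) ↔
      ∀ i : Fin n, rootValue y i = if (i : ℕ) + 1 ∈ J then 0 else (simpleRoot n i t : ℂ) := by
  constructor
  · intro h i
    rw [rootValue_eq_of_rho_eq h, torusAd_repX_apply_superdiagonal]
  · intro h
    rw [rho_eq]
    congr 1
    refine eq_of_superdiagonal_eq (fun _ _ => apply_eq_zero_of_mem_simpleRootSpan
      (sum_smul_simpleRootVector_mem _)) (torusAd_repX_apply_eq_zero t) fun i => ?_
    rw [sum_smul_simpleRootVector_apply, torusAd_repX_apply_superdiagonal, h]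

theorem rootValue_eq_zero_iff {y : W n} (hy : rho n y ∈ tau n J) (i : Fin n) :
    rootValue y i = 0 ↔ (i : ℕ) + 1 ∈ J := by
  obtain ⟨t, ht⟩ := hy
  rw [(rho_eq_torusAd_iff y t).mp ht.symm i]
  simp

end Points

/-! ### Fibres over a torus orbit and the group Z(J) -/

section Fibres

variable {n : ℕ} {J : Finset ℕ}

theorem one_le_coweightNorm_of_mem_closure (hJ : J ⊆ Finset.Icc 1 n) {χ : torus n →* ℂˣ}
    (hχ : χ ∈ Submonoid.closure (Set.range (simpleRoot n))) {d : ℕ} (hd : d ∈ J) :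
    1 ≤ coweightNorm d χ := by
  induction hχ using Submonoid.closure_induction with
  | mem χ h =>
    obtain ⟨i, rfl⟩ := h
    rw [coweightNorm_simpleRoot (Finset.mem_Icc.mp (hJ hd)).2]
    split_ifs
    · exact one_le_pow₀ one_le_two
    · exact le_rfl
  | one => exact (coweightNorm_one d).ge
  | mul χ ψ _ _ h1 h2 =>
    rw [coweightNorm_mul]
    exact one_le_mul_of_one_le_of_one_le h1 h2

theorem coweightNorm_nonneg (d : ℕ) (χ : torus n →* ℂˣ) : 0 ≤ coweightNorm d χ := norm_nonneg _

theorem one_le_coweightNorm (hJ : J ⊆ Finset.Icc 1 n) {L : Subgroup (torus n →* ℂˣ)}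
    {χ : torus n →* ℂˣ} (hχ : χ ∈ coneMonoid n L) {d : ℕ} (hd : d ∈ J) :
    1 ≤ coweightNorm d χ := by
  obtain ⟨_, k, hk, h⟩ := hχ
  have := one_le_coweightNorm_of_mem_closure hJ h hd
  rw [coweightNorm_pow] at this
  exact (one_le_pow_iff_of_nonneg (coweightNorm_nonneg d χ) hk.ne').mp this

/-- The face property: norms on the cone are at least 1, so a product equals 1 only if both factors
do. It also makes the indicator function `basePoint` multiplicative. -/
theorem coweightNorm_mul_eq_one_iff (hJ : J ⊆ Finset.Icc 1 n) {L : Subgroup (torus n →* ℂˣ)}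
    {χ ψ : torus n →* ℂˣ} (hχ : χ ∈ coneMonoid n L) (hψ : ψ ∈ coneMonoid n L) :
    (∀ d ∈ J, coweightNorm d (χ * ψ) = 1) ↔
      (∀ d ∈ J, coweightNorm d χ = 1) ∧ ∀ d ∈ J, coweightNorm d ψ = 1 := by
  constructor
  · intro h
    have key : ∀ d ∈ J, coweightNorm d χ = 1 ∧ coweightNorm d ψ = 1 := fun d hd => by
      have h1 := one_le_coweightNorm hJ hχ hd
      have h2 := one_le_coweightNorm hJ hψ hd
      have h3 := h d hd
      rw [coweightNorm_mul] at h3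
      constructor <;> nlinarith
    exact ⟨fun d hd => (key d hd).1, fun d hd => (key d hd).2⟩
  · rintro ⟨h1, h2⟩ d hd
    rw [coweightNorm_mul, h1 d hd, h2 d hd, one_mul]

theorem closure_simpleRoot_le : Submonoid.closure (Set.range (simpleRoot n)) ≤
    coneMonoid n (weightLattice n) := by
  rw [Submonoid.closure_le]
  rintro _ ⟨i, rfl⟩
  exact coneMonoid_mono n (rootLattice_le n) (simpleRoot_mem_coneMonoid n i)

theorem simpleRoot_face_iff (hJ : J ⊆ Finset.Icc 1 n) (i : Fin n) :
    (∀ d ∈ J, coweightNorm d (simpleRoot n i) = 1) ↔ (i : ℕ) + 1 ∉ J := by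
  constructor
  · intro h hi
    have := h _ hi
    rw [coweightNorm_simpleRoot (by omega), if_pos rfl] at this
    exact absurd this (one_lt_pow₀ one_lt_two (by omega)).ne'
  · intro hi d hd
    rw [coweightNorm_simpleRoot (Finset.mem_Icc.mp (hJ hd)).2, if_neg]
    rintro rfl
    exact hi hd

/-- A point over the orbit of `J` is nonzero exactly on the face of the cone given by `J`. -/
theorem eval_ne_zero_iff (hJ : J ⊆ Finset.Icc 1 n) {y : W n}
    (hy : ∀ i, rootValue y i = 0 ↔ (i : ℕ) + 1 ∈ J) (χ : coneMonoid n (weightLattice n)) :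
    y.eval χ ≠ 0 ↔ ∀ d ∈ J, coweightNorm d χ.1 = 1 := by
  have key : ∀ ψ ∈ Submonoid.closure (Set.range (simpleRoot n)),
      ∀ h : ψ ∈ coneMonoid n (weightLattice n),
      (y.eval ⟨ψ, h⟩ ≠ 0 ↔ ∀ d ∈ J, coweightNorm d ψ = 1) := by
    intro ψ hψ
    induction hψ using Submonoid.closure_induction with
    | mem ψ h =>
      obtain ⟨i, rfl⟩ := h
      intro h
      rw [simpleRoot_face_iff hJ, ← hy]
      rfl
    | one =>
      intro h
      rw [show (⟨1, h⟩ : coneMonoid n (weightLattice n)) = 1 from rfl, map_one]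
      simp [coweightNorm_one]
    | mul ψ φ m1 m2 h1 h2 =>
      intro h
      have m1' := closure_simpleRoot_le m1
      have m2' := closure_simpleRoot_le m2
      rw [show (⟨ψ * φ, h⟩ : coneMonoid n (weightLattice n)) = ⟨ψ, m1'⟩ * ⟨φ, m2'⟩ from rfl,
        map_mul, mul_ne_zero_iff, h1, h2, coweightNorm_mul_eq_one_iff hJ m1' m2']
  obtain ⟨χ, hχ⟩ := χ
  -- Both sides are insensitive to passing from χ to a power, and some positive power is a product
  -- of simple roots.
  obtain ⟨k, hk, h⟩ := hχ.2
  have h1 := key _ h (closure_simpleRoot_le h)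
  rw [show (⟨χ ^ k, closure_simpleRoot_le h⟩ : coneMonoid n (weightLattice n)) = ⟨χ, hχ⟩ ^ k from
    Subtype.ext rfl, map_pow, pow_ne_zero_iff hk.ne'] at h1
  rw [h1]
  refine forall₂_congr fun d _ => ?_
  rw [coweightNorm_pow, pow_eq_one_iff_of_nonneg (coweightNorm_nonneg d χ) hk.ne']

/-- The value of a point of `W` at the character `η`. -/
noncomputable def etaValue (J : Finset ℕ) (y : W n) : ℂ := y.eval ⟨eta n J, eta_mem n J⟩

theorem etaValue_ne_zero (hJ : J ⊆ Finset.Icc 1 n) {y : W n}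
    (hy : ∀ i, rootValue y i = 0 ↔ (i : ℕ) + 1 ∈ J) : etaValue J y ≠ 0 := by
  refine (eval_ne_zero_iff hJ hy _).mpr fun d hd => ?_
  have hd' : d ≤ n + 1 := by have := (Finset.mem_Icc.mp (hJ hd)).2; omega
  refine (coweightNorm_charOf_eq_one hd' _).mpr ?_
  rw [partialSum_etaExp_top]
  have h1 := mul_partialSum_etaExp (gcdJ_pos n J) hd' (gcdJ_dvd_of_mem hd)
  have h2 : ((coindex n J : ℤ) * gcdJ n J) = ((n + 1 : ℕ) : ℤ) := by exact_mod_cast coindex_mul n J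
  rw [← h2, mul_assoc, h1, mul_comm]

theorem etaValue_pow_eq {y y' : W n} (h : ∀ i, rootValue y i = rootValue y' i) :
    etaValue J y ^ gcdJ n J = etaValue J y' ^ gcdJ n J := by
  have key : ∀ y : W n, etaValue J y ^ gcdJ n J = ∏ i, rootValue y i ^ _ := fun y =>
    eval_pow_eq_prod y.eval (eta n J) (simpleRoot n) _ (eta_mem n J)
      (fun i => coneMonoid_mono n (rootLattice_le n) (simpleRoot_mem_coneMonoid n i)) (eta_pow n J)
  rw [key, key]
  simp only [h]

/-- A point over the orbit of `J` is determined by its image in `W_ad` and its value at `η`. -/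
theorem eq_of_etaValue_eq (hJ : J ⊆ Finset.Icc 1 n) {y y' : W n}
    (hy : ∀ i, rootValue y i = 0 ↔ (i : ℕ) + 1 ∈ J) (h : ∀ i, rootValue y i = rootValue y' i)
    (h' : etaValue J y = etaValue J y') : y = y' := by
  have hy' : ∀ i, rootValue y' i = 0 ↔ (i : ℕ) + 1 ∈ J := fun i => by rw [← h, hy]
  refine ToricVariety.ext (MonoidHom.ext fun χ => ?_)
  by_cases hχ : ∀ d ∈ J, coweightNorm d χ.1 = 1
  · refine eval_eq_of_mem_closure y.eval y'.eval (S := faceGens n J) ?_ χ.2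
      (mem_closure_faceGens hJ χ.2.1 hχ)
    rintro s (rfl | ⟨i, hi, rfl⟩)
    · exact ⟨eta_mem n J, h', etaValue_ne_zero hJ hy'⟩
    · exact ⟨coneMonoid_mono n (rootLattice_le n) (simpleRoot_mem_coneMonoid n i), h i,
        fun e => hi ((hy' i).mp e)⟩
  · rw [← eval_ne_zero_iff hJ hy, not_not] at hχ
    have hχ' := hχ
    rw [← not_not (a := y.eval χ = 0), ← ne_eq, eval_ne_zero_iff hJ hy,
      ← eval_ne_zero_iff hJ hy', not_not] at hχ'
    rw [hχ, hχ']

theorem rootValue_smul (t : torus n) (y : W n) (i : Fin n) :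
    rootValue (t • y) i = (simpleRoot n i t : ℂ) * rootValue y i := rfl

theorem rootValue_centre_smul (z : centre n) (y : W n) (i : Fin n) :
    rootValue (z • y) i = rootValue y i := by
  change (simpleRoot n i z.1 : ℂ) * rootValue y i = rootValue y i
  rw [simpleRoot_centre, Units.val_one, one_mul]

theorem etaValue_centre_smul (z : centre n) (y : W n) :
    etaValue J (z • y) = ((scalarOf z ^ coindex n J : ℂˣ) : ℂ) * etaValue J y := by
  rw [← eta_centre]; rfl

theorem rho_centre_smul (z : centre n) (y : W n) : rho n (z • y) = rho n y := by
  rw [rho_eq, rho_eq]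
  simp only [rootValue_centre_smul]

theorem centre_smul_eq_self_iff (hJ : J ⊆ Finset.Icc 1 n) {y : W n}
    (hy : ∀ i, rootValue y i = 0 ↔ (i : ℕ) + 1 ∈ J) (z : centre n) :
    z • y = y ↔ scalarOf z ^ coindex n J = 1 := by
  constructor
  · intro h
    have h1 := etaValue_centre_smul (J := J) z y
    rw [h] at h1
    exact Units.ext (mul_right_cancel₀ (etaValue_ne_zero hJ hy)
      (h1.symm.trans (one_mul _).symm))
  · intro h
    refine (eq_of_etaValue_eq hJ hy (fun i => (rootValue_centre_smul z y i).symm) ?_).symm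
    rw [etaValue_centre_smul, h, Units.val_one, one_mul]

/-- Any m-th root w of ξ satisfies w^(n+1) = ξ^c = 1, so it is a central scalar. -/
theorem exists_scalarOf_pow_eq (J : Finset ℕ) {ξ : ℂˣ} (hξ : ξ ^ gcdJ n J = 1) :
    ∃ z : centre n, scalarOf z ^ coindex n J = ξ := by
  have hm : coindex n J ≠ 0 := fun h => by
    have := coindex_mul n J
    rw [h, zero_mul] at this
    omega
  obtain ⟨w, hw⟩ := IsAlgClosed.exists_pow_nat_eq (ξ : ℂ) (Nat.pos_of_ne_zero hm)
  have hw0 : w ≠ 0 := by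
    rintro rfl
    rw [zero_pow hm] at hw
    exact ξ.ne_zero hw.symm
  have hw' : Units.mk0 w hw0 ^ coindex n J = ξ := Units.ext (by simpa using hw)
  obtain ⟨z, hz⟩ := exists_scalarOf_eq (n := n) (Units.mk0 w hw0)
    (by rw [← coindex_mul n J, pow_mul, hw', hξ])
  exact ⟨z, by rw [hz, hw']⟩

/-- The ratio of the two values at η is a c-th root of unity, because their c-th powers are the same
product of root values. -/
theorem exists_centre_smul_eq (hJ : J ⊆ Finset.Icc 1 n) {y y' : W n}
    (hy : ∀ i, rootValue y i = 0 ↔ (i : ℕ) + 1 ∈ J) (h : ∀ i, rootValue y i = rootValue y' i) :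
    ∃ z : centre n, z • y = y' := by
  have hy' : ∀ i, rootValue y' i = 0 ↔ (i : ℕ) + 1 ∈ J := fun i => by rw [← h, hy]
  have n1 := etaValue_ne_zero hJ hy
  have n2 := etaValue_ne_zero hJ hy'
  obtain ⟨z, hz⟩ := exists_scalarOf_pow_eq (n := n) J
    (ξ := Units.mk0 (etaValue J y' / etaValue J y) (div_ne_zero n2 n1)) (Units.ext (by
      rw [Units.val_pow_eq_pow_val, Units.val_mk0, div_pow, etaValue_pow_eq h, Units.val_one,
        div_self (pow_ne_zero _ n2)]))
  refine ⟨z, eq_of_etaValue_eq hJ (fun i => by rw [rootValue_centre_smul, hy])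
    (fun i => by rw [rootValue_centre_smul, h]) ?_⟩
  rw [etaValue_centre_smul, hz, Units.val_mk0, div_mul_cancel₀ _ n1]

open Classical in
/-- The distinguished point of the orbit of `J`: the indicator function of the face. -/
noncomputable def basePoint (hJ : J ⊆ Finset.Icc 1 n) : W n where
  eval := {
    toFun := fun χ => if ∀ d ∈ J, coweightNorm d χ.1 = 1 then 1 else 0
    map_one' := if_pos fun d _ => coweightNorm_one d
    map_mul' := fun χ ψ => by
      have h := coweightNorm_mul_eq_one_iff hJ χ.2 ψ.2
      change (if ∀ d ∈ J, coweightNorm d (χ.1 * ψ.1) = 1 then (1 : ℂ) else 0) = _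
      simp only [h, ite_and, mul_ite, mul_one, mul_zero]
      split_ifs <;> rfl }

theorem rootValue_basePoint (hJ : J ⊆ Finset.Icc 1 n) (i : Fin n) :
    rootValue (basePoint hJ) i = if (i : ℕ) + 1 ∈ J then 0 else 1 := by
  change (if ∀ d ∈ J, coweightNorm d (simpleRoot n i) = 1 then (1 : ℂ) else 0) = _
  simp only [simpleRoot_face_iff hJ, ite_not]

theorem fibre_nonempty (hJ : J ⊆ Finset.Icc 1 n) (t : torus n) :
    (fibre n (toWad n (torusAd n t (repX n J)))).Nonempty := by
  refine ⟨t • basePoint hJ, (rho_eq_torusAd_iff _ t).mpr fun i => ?_⟩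
  rw [rootValue_smul, rootValue_basePoint]
  split_ifs <;> simp

/-- The criterion for fixing a point over τ_J does not depend on the point, so one existing point
suffices. -/
theorem mem_fixer_iff (hJ : J ⊆ Finset.Icc 1 n) (z : centre n) :
    z ∈ fixer n J ↔ scalarOf z ^ coindex n J = 1 := by
  rw [fixer, mem_fixingSubgroup_iff]
  constructor
  · intro h
    obtain ⟨y, hy⟩ := fibre_nonempty hJ (1 : torus n)
    have hy' : rho n y ∈ tau n J := ⟨1, hy.symm⟩
    exact (centre_smul_eq_self_iff hJ (rootValue_eq_zero_iff hy') z).mp (h y hy')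
  · intro h y hy
    exact (centre_smul_eq_self_iff hJ (rootValue_eq_zero_iff hy) z).mpr h

theorem stabilizer_eq_fixer (hJ : J ⊆ Finset.Icc 1 n) {y : W n} (hy : rho n y ∈ tau n J) :
    MulAction.stabilizer (centre n) y = fixer n J := by
  ext z
  rw [MulAction.mem_stabilizer_iff, mem_fixer_iff hJ,
    centre_smul_eq_self_iff hJ (rootValue_eq_zero_iff hy)]

theorem orbit_eq_fibre (hJ : J ⊆ Finset.Icc 1 n) {y : W n} (t : torus n)
    (hy : y ∈ fibre n (toWad n (torusAd n t (repX n J)))) :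
    MulAction.orbit (centre n) y = fibre n (toWad n (torusAd n t (repX n J))) := by
  refine Set.Subset.antisymm ?_ fun y' hy' => ?_
  · rintro _ ⟨z, rfl⟩
    exact (rho_centre_smul z y).trans hy
  · refine exists_centre_smul_eq hJ (rootValue_eq_zero_iff ⟨t, hy.symm⟩) fun i => ?_
    rw [(rho_eq_torusAd_iff y t).mp hy, (rho_eq_torusAd_iff y' t).mp hy']

/-- The power of the scalar by which the centre acts on `η`. -/
noncomputable def scalarPow (n : ℕ) (J : Finset ℕ) : centre n →* ℂˣ where
  toFun z := scalarOf z ^ coindex n J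
  map_one' := by rw [← eta_centre]; exact map_one (eta n J)
  map_mul' z w := by rw [scalarOf_mul, mul_pow]

theorem ker_scalarPow (hJ : J ⊆ Finset.Icc 1 n) : (scalarPow n J).ker = fixer n J := by
  ext z
  rw [MonoidHom.mem_ker, mem_fixer_iff hJ]; rfl

theorem range_scalarPow : (scalarPow n J).range = rootsOfUnity (gcdJ n J) ℂ := by
  ext ξ
  rw [mem_rootsOfUnity]
  constructor
  · rintro ⟨z, rfl⟩
    change (scalarOf z ^ coindex n J) ^ gcdJ n J = 1
    rw [← pow_mul, coindex_mul, scalarOf_pow]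
  · exact exists_scalarOf_pow_eq J

theorem nonempty_Z_mulEquiv_zmod (hJ : J ⊆ Finset.Icc 1 n) :
    Nonempty (Z n J ≃* Multiplicative (ZMod (gcdJ n J))) := by
  have : NeZero (gcdJ n J) := ⟨(gcdJ_pos n J).ne'⟩
  have e1 : Z n J ≃* rootsOfUnity (gcdJ n J) ℂ :=
    (QuotientGroup.quotientMulEquivOfEq (ker_scalarPow hJ).symm).trans
      ((QuotientGroup.quotientKerEquivRange (scalarPow n J)).trans
        (MulEquiv.subgroupCongr range_scalarPow))
  refine ⟨e1.trans (mulEquivOfCyclicCardEq ?_)⟩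
  rw [HasEnoughRootsOfUnity.natCard_rootsOfUnity]
  exact (Nat.card_zmod _).symm

end Fibres

/-- The greatest common divisor of a set of positive integers is that of its successive
differences. -/
theorem gcdJ_eq_gcd_partsP {n : ℕ} {J : Finset ℕ} (hJ : J ⊆ Finset.Icc 1 n) :
    gcdJ n J = (partsP n J).gcd := by
  have hprev : ∀ d ∈ insert (n + 1) J, ∃ p ∈ insert 0 J, p < d ∧
      ((insert 0 J).filter (· < d)).sup id = p := by
    intro d hd
    have hd0 : 0 < d := by
      rcases Finset.mem_insert.mp hd with rfl | hd
      · exact Nat.succ_pos n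
      · exact (Finset.mem_Icc.mp (hJ hd)).1
    have hne : ((insert 0 J).filter (· < d)).Nonempty :=
      ⟨0, Finset.mem_filter.mpr ⟨Finset.mem_insert_self _ _, hd0⟩⟩
    obtain ⟨p, hp, e⟩ := Finset.exists_mem_eq_sup _ hne id
    exact ⟨p, (Finset.mem_filter.mp hp).1, (Finset.mem_filter.mp hp).2, e⟩
  refine dvd_antisymm (Multiset.dvd_gcd.mpr fun b hb => ?_) (Finset.dvd_gcd fun d hd => ?_)
  · obtain ⟨d, hd, rfl⟩ := Multiset.mem_map.mp hb
    obtain ⟨p, hp, _, e⟩ := hprev d hd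
    rw [e]
    refine Nat.dvd_sub (Finset.gcd_dvd (f := id) hd) ?_
    rcases Finset.mem_insert.mp hp with rfl | hp
    · exact dvd_zero _
    · exact gcdJ_dvd_of_mem hp
  · change _ ∣ d
    -- Each d is its gap plus the preceding element, so divisibility climbs from 0.
    induction d using Nat.strong_induction_on with
    | _ d ih =>
      obtain ⟨p, hp, hlt, e⟩ := hprev d hd
      have h1 : (partsP n J).gcd ∣ d - p :=
        Multiset.gcd_dvd (Multiset.mem_map.mpr ⟨d, hd, by rw [e]⟩)
      have h2 : (partsP n J).gcd ∣ p := by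
        rcases Finset.mem_insert.mp hp with rfl | hp
        · exact dvd_zero _
        · exact ih p hlt (Finset.mem_insert_of_mem hp)
      have h3 := dvd_add h1 h2
      rwa [Nat.sub_add_cancel hlt.le] at h3

end Graham

theorem mainTheorem5 (n : ℕ) (hn : 1 ≤ n) (J : Finset ℕ) (hJ : J ⊆ Finset.Icc 1 n)
    (x : Graham.nilradical n) (hx : x ∈ Graham.simpleRootSpan n)
    (hxJ : Graham.toWad n x ∈ Graham.tau n J) :
    ((Graham.fibre n (Graham.toWad n x)).Nonempty ∧
      ∀ y ∈ Graham.fibre n (Graham.toWad n x),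
        MulAction.orbit (Graham.centre n) y = Graham.fibre n (Graham.toWad n x) ∧
        MulAction.stabilizer (Graham.centre n) y = Graham.fixer n J) ∧
    Nonempty (Graham.Z n J ≃* Graham.orbitPi1 n x) ∧
    Nonempty (Graham.Z n J ≃* Multiplicative (ZMod ((insert (n + 1) J).gcd id))) ∧
    Nonempty (Graham.orbitPi1 n x ≃* Multiplicative (ZMod ((insert (n + 1) J).gcd id))) ∧
    (insert (n + 1) J).gcd id = (Graham.partsP n J).gcd := by
  obtain ⟨t, rfl⟩ := Graham.eq_torusAd_of_toWad_mem_tau hx hxJ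
  obtain ⟨e1⟩ := Graham.nonempty_mulEquiv_orbitPi1_torusAd hJ t _ (Graham.mem_fixer_iff hJ)
  obtain ⟨e2⟩ := Graham.nonempty_Z_mulEquiv_zmod hJ
  refine ⟨⟨Graham.fibre_nonempty hJ t, fun y hy => ⟨Graham.orbit_eq_fibre hJ t hy,
    Graham.stabilizer_eq_fixer hJ ⟨t, hy.symm⟩⟩⟩, ⟨e1⟩, ⟨e2⟩, ⟨e1.symm.trans e2⟩,
    Graham.gcdJ_eq_gcd_partsP hJ⟩
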